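/- **Setting.** An $(m+n)$-qubit unitary $U$ is an $(\alpha,m,\epsilon)$-block-encoding of an $n$-qubit operator $A$ if $\|A-\alpha(\langle 0^m|\otimes I)\,U\,(|0^m\rangle\otimes I)\|\le\epsilon$ (spectral norm). Let $H$ be a Hermitian $n$-qubit operator, let $U_H$ be an $(\alpha,m,0)$-block-encoding of $H$ with $\alpha>0$, and let $\lambda$ be an eigenvalue of $H$ separated from the rest of the spectrum by a gap $\Delta>0$, i.e. $|\mu-\lambda|\ge\Delta$ for every eigenvalue $\mu\ne\lambda$ of $H$. Let $P_\lambda$ be the orthogonal projector onto the $\lambda$-eigenspace of $H$ and $R_\lambda=2P_\lambda-I$. Put $$\widetilde H=\frac{H-\lambda I}{\alpha+|\lambda|},\qquad \widetilde\Delta=\min\Big\{\frac{\Delta}{2\alpha},\frac1{\sqrt{12}}\Big\},$$ and, for $\ell\ge 0$ and $0<\delta<1$, with $T_\ell$ the Chebyshev polynomial of the first kind, $$R_\ell(x;\delta)=\frac{T_\ell\big(-1+2\frac{x^2-\delta^2}{1-\delta^2}\big)}{T_\ell\big(-1+2\frac{-\delta^2}{1-\delta^2}\big)},\qquad S_\ell(x;\delta)=\frac{2R_\ell(x;\delta)-1}{\max_{y\in[-1,1]}|2R_\ell(y;\delta)-1|}.$$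 **Theorem.** There is an absolute constant $C>0$ such that for all $n,m\ge 0$, $\alpha>0$, $\lambda\in\mathbb R$, $\Delta>0$ and $0<\epsilon\le 1$ there are an integer $\ell\ge0$ and a quantum circuit on $(m+2)+n$ qubits, built from one- and two-qubit gates and queries to (controlled-) $U_H$ and $U_H^\dagger$ and otherwise independent of $H$ and $U_H$, that makes exactly $2\ell$ queries, where $$2\ell\le C\,\frac{\alpha}{\Delta}\log\frac2\epsilon ,$$ and uses at most $C\,\frac{(m+1)\alpha}{\Delta}\log\frac2\epsilon$ one- and two-qubit gates, such that for all $H$ and $U_H$ as above the unitary implemented by the circuit is a $(1,m+2,0)$-block-encoding of $S_\ell(\widetilde H;\widetilde\Delta)$ and a $(1,m+2,\epsilon)$-block-encoding of the reflection $R_\lambda$. In particular (for $0<\epsilon\le\frac12$ and $m\ge1$) the construction uses $\mathcal O((\alpha/\Delta)\log(1/\epsilon))$ queries and $\mathcal O((m\alpha/\Delta)\log(1/\epsilon))$ other primitive gates. -/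

import Mathlib

namespace EigFilter

/-! ### Qubit registers, operators and block-encodings -/

/-- Computational basis of a register whose qubits are labelled by `Q`. -/
abbrev Basis (Q : Type) : Type := Q → Fin 2

/-- Operators (complex matrices) on a register whose qubits are labelled by `Q`. -/
abbrev Op (Q : Type) : Type := Matrix (Basis Q) (Basis Q) ℂ

/-- The qubit labels of a register of `a` ancilla qubits and `n` system qubits. -/
abbrev Reg (a n : ℕ) : Type := Fin a ⊕ Fin n

/-- The `n`-qubit operator `(⟨0^a| ⊗ I) U (|0^a⟩ ⊗ I)`. -/
def zeroBlock {a n : ℕ} (U : Op (Reg a n)) : Op (Fin n) :=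
  Matrix.of fun i j => U (Sum.elim 0 i) (Sum.elim 0 j)

open scoped Matrix.Norms.L2Operator in
/-- `U` is an `(α, a, ε)`-block-encoding of the `n`-qubit operator `A`: it is an `(a+n)`-qubit
unitary with `‖A - α (⟨0^a| ⊗ I) U (|0^a⟩ ⊗ I)‖ ≤ ε` in the spectral norm. -/
def IsBlockEncoding (α : ℝ) (a : ℕ) (ε : ℝ) {n : ℕ} (U : Op (Reg a n)) (A : Op (Fin n)) : Prop :=
  U ∈ Matrix.unitaryGroup (Basis (Reg a n)) ℂ ∧ ‖A - (α : ℂ) • zeroBlock U‖ ≤ ε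

/-! ### Quantum circuits with queries to an oracle -/

/-- The operator on the register `Q` that applies `V` to the qubits `e k` (in the order given by
`e`) and the identity to all other qubits. -/
def applyOn {K Q : Type} [Fintype K] [Fintype Q] [DecidableEq Q] (e : K ↪ Q) (V : Op K) : Op Q :=
  Matrix.of fun x y =>
    if ∀ q, (∀ k, e k ≠ q) → x q = y q then V (fun k => x (e k)) (fun k => y (e k)) else 0

/-- `W` controlled on the qubit `c` being in the state `1` (for `W` that does not act on `c`). -/
def controlled {Q : Type} [Fintype Q] [DecidableEq Q] (c : Q) (W : Op Q) : Op Q :=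
  Matrix.of fun x y => if x c = 1 then W x y else if x = y then 1 else 0

/-- The elementary steps of a circuit on the register `Q` with access to an oracle, an unknown
unitary on qubits labelled by `K`. The primitive gates are the one- and two-qubit unitaries.
In a query, `adj = true` means that the adjoint of the oracle is applied. -/
inductive Step (K Q : Type) : Type
  | gateOne (V : Matrix.unitaryGroup (Basis (Fin 1)) ℂ) (e : Fin 1 ↪ Q)
  | gateTwo (V : Matrix.unitaryGroup (Basis (Fin 2)) ℂ) (e : Fin 2 ↪ Q)
  | query (adj : Bool) (e : K ↪ Q)
  | controlledQuery (adj : Bool) (e : K ↪ Q) (c : Q) (hc : ∀ k, e k ≠ c)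

/-- Number of oracle queries (`U`, `U†` and their controlled versions) in a step. -/
def Step.queries {K Q : Type} : Step K Q → ℕ
  | .gateOne _ _ => 0
  | .gateTwo _ _ => 0
  | .query _ _ => 1
  | .controlledQuery _ _ _ _ => 1

/-- Number of primitive gates in a step. -/
def Step.gates {K Q : Type} : Step K Q → ℕ
  | .gateOne _ _ => 1
  | .gateTwo _ _ => 1
  | .query _ _ => 0
  | .controlledQuery _ _ _ _ => 0

/-- The oracle or its adjoint. -/
def oracleOp {K : Type} [Fintype K] (U : Op K) (adj : Bool) : Op K :=
  if adj then U.conjTranspose else U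

/-- The operator performed by a step when the oracle is `U`. -/
def Step.eval {K Q : Type} [Fintype K] [Fintype Q] [DecidableEq Q] (U : Op K) :
    Step K Q → Op Q
  | .gateOne V e => applyOn e (V : Op (Fin 1))
  | .gateTwo V e => applyOn e (V : Op (Fin 2))
  | .query adj e => applyOn e (oracleOp U adj)
  | .controlledQuery adj e c _ => controlled c (applyOn e (oracleOp U adj))

/-- A circuit is a list of steps; the head of the list is performed first. -/
abbrev Circuit (K Q : Type) : Type := List (Step K Q)

/-- Total number of oracle queries of a circuit. -/
def Circuit.queries {K Q : Type} (c : Circuit K Q) : ℕ := (c.map Step.queries).sum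

/-- Total number of primitive gates of a circuit. -/
def Circuit.gates {K Q : Type} (c : Circuit K Q) : ℕ := (c.map Step.gates).sum

/-- The operator performed by a circuit when the oracle is `U`. -/
def Circuit.eval {K Q : Type} [Fintype K] [Fintype Q] [DecidableEq Q] (U : Op K) :
    List (Step K Q) → Op Q
  | [] => 1
  | s :: c => Circuit.eval U c * s.eval U

/-! ### Spectral notions -/

/-- `μ` is an eigenvalue of `H`. -/
def IsEigenvalue {n : ℕ} (H : Op (Fin n)) (μ : ℝ) : Prop :=
  Module.End.HasEigenvalue (Matrix.toEuclideanLin H) (μ : ℂ)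

/-- `lam` is an eigenvalue of `H` separated from the rest of the spectrum by a gap `Δ`. -/
def IsGappedEigenvalue {n : ℕ} (H : Op (Fin n)) (lam Δ : ℝ) : Prop :=
  IsEigenvalue H lam ∧ ∀ μ : ℝ, IsEigenvalue H μ → μ ≠ lam → Δ ≤ |μ - lam|

/-- The orthogonal projector `P_lam` onto the `lam`-eigenspace of `H`. -/
noncomputable def eigenprojector {n : ℕ} (H : Op (Fin n)) (lam : ℝ) : Op (Fin n) :=
  (Matrix.toEuclideanCLM (𝕜 := ℂ) (n := Basis (Fin n))).symm
    (Module.End.eigenspace (Matrix.toEuclideanLin H) (lam : ℂ)).starProjection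

/-- The reflection `2 P_lam - I` about the `lam`-eigenspace of `H`. -/
noncomputable def reflection {n : ℕ} (H : Op (Fin n)) (lam : ℝ) : Op (Fin n) :=
  (2 : ℂ) • eigenprojector H lam - 1

/-- The shifted and rescaled operator `(H - lam I) / (α + |lam|)`. -/
noncomputable def shifted {n : ℕ} (H : Op (Fin n)) (α lam : ℝ) : Op (Fin n) :=
  (((α + |lam|)⁻¹ : ℝ) : ℂ) • (H - (lam : ℂ) • (1 : Op (Fin n)))

/-- The gap parameter `Δ / (2 α)`, capped at `1 / √12`. -/
noncomputable def scaledGap (α Δ : ℝ) : ℝ := min (Δ / (2 * α)) (1 / √12)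

/-! ### The filtering polynomials -/

open Polynomial in
/-- `T_ℓ (-1 + 2 (x² - δ²) / (1 - δ²))` as a polynomial in `x`, with `T_ℓ` the Chebyshev
polynomial of the first kind. -/
noncomputable def chebFilter (ℓ : ℕ) (δ : ℝ) : ℝ[X] :=
  (Chebyshev.T ℝ (ℓ : ℤ)).comp (-1 + C (2 / (1 - δ ^ 2)) * (X ^ 2 - C (δ ^ 2)))

open Polynomial in
/-- The minimax filtering polynomial `R_ℓ(x; δ)`, normalised to be `1` at `0`. -/
noncomputable def filterPoly (ℓ : ℕ) (δ : ℝ) : ℝ[X] :=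
  C ((chebFilter ℓ δ).eval 0)⁻¹ * chebFilter ℓ δ

open Polynomial in
/-- `S_ℓ(x; δ) = (2 R_ℓ(x; δ) - 1) / max_{y ∈ [-1,1]} |2 R_ℓ(y; δ) - 1|`. -/
noncomputable def reflectionPoly (ℓ : ℕ) (δ : ℝ) : ℝ[X] :=
  C (sSup ((fun y : ℝ => |2 * (filterPoly ℓ δ).eval y - 1|) '' Set.Icc (-1) 1))⁻¹ *
    (2 * filterPoly ℓ δ - 1)

end EigFilter

/-!
The circuit applies a polynomial singular value transformation to a block-encoding of the shifted
operator `A = (H - lam) / (α + |lam|)`; the polynomial is close to `1` at `0` and to `-1` on the rest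
of the spectrum of `A`, so that its value at `A` is close to the reflection.

*Degenerate range.* The spectrum of `H` lies in `[-α, α]`. A gap larger than `2 α` therefore forces
`H = lam I`, and the empty circuit works. Otherwise `(α / Δ) log (2 / ε)` is bounded below, which
absorbs all additive constants in the resource bounds (`exists_degree`).

*Accuracy.* The Chebyshev polynomial is bounded by `1` on `[-1, 1]` and grows like a hyperbolic
cosine beyond it, so a degree of order `log (1 / ε) / δ` makes the filtering polynomial smaller than
`ε` outside a gap `δ` (`filterBound_le_exp`). The spectral theorem turns the scalar estimates into a
bound in operator norm (`norm_reflection_sub_aeval_shifted_le`).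

*Phases.* The reflection polynomial is `s (x²)` with `|s| ≤ 1` on `[0, 1]`. Lukács' theorem
(`hasLukacsForm_of_nonneg`) writes `1 - s (y)²` as `a (y)² + y (1 - y) b (y)²`, and therefore
`p = s (x²) + i a (x²)` and `q = x b (x²)` satisfy `|p|² + (1 - x²) |q|² = 1`. Such a pair can be
unwound degree by degree into phases (`exists_phases_of_norm_eq_one`), so `s (x²)` is the average of
the first components of the pairs belonging to the phases and to their negatives
(`exists_phases_of_abs_le_one`).

*Circuit.* One further qubit, which controls the query and on which a gate acts before and after it,
combines the oracle and the identity into a unitary `W` with block `A`. With `J` the inclusion of the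
subspace on which the ancillas vanish, applying `W` and `W†` alternately to `J`, with phases in
between, gives `J p(A) + (W J - J A) q(A)`, or the same with `W†` for `W`, where `(p, q)` obeys
exactly the recursion that defines the pair of polynomials (`qspPair`). The last ancilla, in the
state `(|0⟩ + |1⟩) / √2`, selects the sign of the phases and thus performs the average; this is
`zeroBlock_filterCircuit_eval`.

*Gate count.* The phase `exp (± i φ)` on and off the subspace of vanishing ancillas has to be applied
with `O(m)` gates and without work qubits. It is obtained from the commutator of two not gates that
are controlled by one half of the ancillas each and one of which is conjugated by a `Z` rotation; a
not gate controlled by one half can borrow the qubits of the other half (`projectorPhase_eval`).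
-/

namespace EigFilter

/-! ### Nonnegative polynomials on the unit interval -/

open Polynomial in
/-- Certificates of nonnegativity on `[0, 1]` for polynomials of degree at most `N`: the form
`a² + y (1 - y) b²` for even `N = 2 k`, and `y a² + (1 - y) b²` for odd `N = 2 k + 1`. -/
def HasLukacsForm (N : ℕ) (f : ℝ[X]) : Prop :=
  ∃ k : ℕ, ∃ a b : ℝ[X], a.degree < ((k + 1 : ℕ) : WithBot ℕ) ∧
    ((N = 2 * k ∧ b.degree < (k : WithBot ℕ) ∧ f = a ^ 2 + X * (1 - X) * b ^ 2) ∨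
     (N = 2 * k + 1 ∧ b.degree < ((k + 1 : ℕ) : WithBot ℕ) ∧ f = X * a ^ 2 + (1 - X) * b ^ 2))

open Polynomial in
lemma degree_mul_lt_of_natDegree_le {p b : ℝ[X]} {i j k : ℕ} (hp : p.natDegree ≤ i)
    (hb : b.degree < (j : WithBot ℕ)) (h : i + j ≤ k) : (p * b).degree < (k : WithBot ℕ) := by
  by_cases hb0 : b = 0
  · simp [hb0]
  · have h1 : b.natDegree < j := (natDegree_lt_iff_degree_lt hb0).2 hb
    refine lt_of_le_of_lt degree_le_natDegree ?_
    have h2 := natDegree_mul_le (p := p) (q := b)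
    exact_mod_cast (by omega : (p * b).natDegree < k)

open Polynomial in
lemma degree_add_lt_of_lt {a b : ℝ[X]} {k : WithBot ℕ} (ha : a.degree < k) (hb : b.degree < k) :
    (a + b).degree < k := lt_of_le_of_lt (degree_add_le _ _) (max_lt ha hb)

open Polynomial in
lemma degree_sub_lt_of_lt {a b : ℝ[X]} {k : WithBot ℕ} (ha : a.degree < k) (hb : b.degree < k) :
    (a - b).degree < k := lt_of_le_of_lt (degree_sub_le _ _) (max_lt ha hb)

open Polynomial in
/-- Linear polynomials that are nonnegative on `[0, 1]` switch between the two forms. -/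
lemma HasLukacsForm.linear_mul {N : ℕ} {f : ℝ[X]} (hf : HasLukacsForm N f) {u v : ℝ}
    (hu : 0 ≤ u) (hv : 0 ≤ v) : HasLukacsForm (N + 1) ((C u * X + C v * (1 - X)) * f) := by
  obtain ⟨k, a, b, ha, ⟨hN, hb, rfl⟩ | ⟨hN, hb, rfl⟩⟩ := hf
  all_goals
    have e1 : (C u : ℝ[X]) = C (√u) ^ 2 := by rw [← C_pow, Real.sq_sqrt hu]
    have e2 : (C v : ℝ[X]) = C (√v) ^ 2 := by rw [← C_pow, Real.sq_sqrt hv]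
    set s := √u
    set t := √v
    have hX : (C s * X : ℝ[X]).natDegree ≤ 1 := by compute_degree
    have hX' : (C t * X : ℝ[X]).natDegree ≤ 1 := by compute_degree
    have hY : (C t * (1 - X) : ℝ[X]).natDegree ≤ 1 := by compute_degree
    have hC (w : ℝ) : (C w : ℝ[X]).natDegree ≤ 0 := by simp
  · refine ⟨k, C s * a - C t * (1 - X) * b, C t * a + C s * X * b,
      degree_sub_lt_of_lt (degree_mul_lt_of_natDegree_le (hC s) ha (by omega))
        (degree_mul_lt_of_natDegree_le hY hb (by omega)), Or.inr ⟨by omega,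
      degree_add_lt_of_lt (degree_mul_lt_of_natDegree_le (hC t) ha (by omega))
        (degree_mul_lt_of_natDegree_le hX hb (by omega)), ?_⟩⟩
    rw [e1, e2]; ring
  · refine ⟨k + 1, C s * X * a + C t * (1 - X) * b, C s * b - C t * a,
      degree_add_lt_of_lt (degree_mul_lt_of_natDegree_le hX ha (by omega))
        (degree_mul_lt_of_natDegree_le hY hb (by omega)), Or.inl ⟨by omega,
      degree_sub_lt_of_lt (degree_mul_lt_of_natDegree_le (hC s) hb (by omega))
        (degree_mul_lt_of_natDegree_le (hC t) ha (by omega)), ?_⟩⟩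
    rw [e1, e2]; ring

open Polynomial in
lemma HasLukacsForm.succ {N : ℕ} {f : ℝ[X]} (hf : HasLukacsForm N f) :
    HasLukacsForm (N + 1) f := by
  have h := hf.linear_mul zero_le_one zero_le_one
  have e : ((C 1 * X + C 1 * (1 - X)) * f : ℝ[X]) = f := by simp
  rwa [e] at h

open Polynomial in
lemma HasLukacsForm.mono {N M : ℕ} {f : ℝ[X]} (hf : HasLukacsForm N f) (h : N ≤ M) :
    HasLukacsForm M f := by
  induction M, h using Nat.le_induction with
  | base => exact hf
  | succ M _ ih => exact ih.succ

open Polynomial in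
/-- The form `p² + y (1 - y) c²` with `p` linear and `c` constant is multiplicative, and every
monic quadratic without simple real roots is of this form: interpolate its square root at the
endpoints, with opposite signs. -/
lemma HasLukacsForm.quadratic_mul {N : ℕ} {f : ℝ[X]} (hf : HasLukacsForm N f) {p s : ℝ}
    (hs : p ^ 2 ≤ s) : HasLukacsForm (N + 2) ((X ^ 2 - C (2 * p) * X + C s) * f) := by
  have h0 : 0 ≤ s := (sq_nonneg p).trans hs
  have h1 : 0 ≤ 1 - 2 * p + s := by nlinarith [sq_nonneg (1 - p)]
  set A := √(1 - 2 * p + s) with hA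
  set B := √s with hB
  have hA2 : A ^ 2 = 1 - 2 * p + s := Real.sq_sqrt h1
  have hB2 : B ^ 2 = s := Real.sq_sqrt h0
  have hA0 : 0 ≤ A := Real.sqrt_nonneg _
  have hB0 : 0 ≤ B := Real.sqrt_nonneg _
  have hm : 0 ≤ 2 * s - 2 * p + 2 * (A * B) := by
    have hle : p - s ≤ A * B := by
      refine (abs_le_of_sq_le_sq' ?_ (mul_nonneg hA0 hB0)).2
      rw [mul_pow, hA2, hB2]
      nlinarith
    linarith
  set c := √(2 * s - 2 * p + 2 * (A * B)) with hc
  have hc2 : c ^ 2 = 2 * s - 2 * p + 2 * (A * B) := Real.sq_sqrt hm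
  have eC : (C c : ℝ[X]) ^ 2 = 2 * C s - 2 * C p + 2 * (C A * C B) := by
    rw [← C_pow, hc2]; simp [map_ofNat C 2]
  have eA : (C A : ℝ[X]) ^ 2 = 1 - 2 * C p + C s := by rw [← C_pow, hA2]; simp [map_ofNat C 2]
  have eB : (C B : ℝ[X]) ^ 2 = C s := by rw [← C_pow, hB2]
  set q : ℝ[X] := C A * X - C B * (1 - X) with hq
  have hquad : (X ^ 2 - C (2 * p) * X + C s : ℝ[X]) = q ^ 2 + X * (1 - X) * C c ^ 2 := by
    have e2 : (C (2 * p) : ℝ[X]) = 2 * C p := by simp [map_ofNat C 2]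
    rw [eC, hq, e2]
    linear_combination (-X ^ 2) * eA - (1 - X) ^ 2 * eB
  have hqd : q.natDegree ≤ 1 := by rw [hq]; compute_degree
  have hC : (C c : ℝ[X]).natDegree ≤ 0 := by simp
  have hX : (C c * X : ℝ[X]).natDegree ≤ 1 := by compute_degree
  have hY : (C c * (1 - X) : ℝ[X]).natDegree ≤ 1 := by compute_degree
  have hXY : (C c * X * (1 - X) : ℝ[X]).natDegree ≤ 2 := by compute_degree
  rw [hquad]
  obtain ⟨k, a, b, ha, ⟨hN, hb, rfl⟩ | ⟨hN, hb, rfl⟩⟩ := hf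
  · by_cases hk : k = 0
    · have hb0 : b = 0 := by
        rw [hk] at hb
        simpa using hb
      refine ⟨k + 1, q * a, C c * a, degree_mul_lt_of_natDegree_le hqd ha (by omega),
        Or.inl ⟨by omega, degree_mul_lt_of_natDegree_le hC ha (by omega), ?_⟩⟩
      rw [hb0]; ring
    · refine ⟨k + 1, q * a - C c * X * (1 - X) * b, q * b + C c * a,
        degree_sub_lt_of_lt (degree_mul_lt_of_natDegree_le hqd ha (by omega))
          (degree_mul_lt_of_natDegree_le hXY hb (by omega)), Or.inl ⟨by omega,
        degree_add_lt_of_lt (degree_mul_lt_of_natDegree_le hqd hb (by omega))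
          (degree_mul_lt_of_natDegree_le hC ha (by omega)), ?_⟩⟩
      ring
  · refine ⟨k + 1, q * a - C c * (1 - X) * b, q * b + C c * X * a,
      degree_sub_lt_of_lt (degree_mul_lt_of_natDegree_le hqd ha (by omega))
        (degree_mul_lt_of_natDegree_le hY hb (by omega)), Or.inr ⟨by omega,
      degree_add_lt_of_lt (degree_mul_lt_of_natDegree_le hqd hb (by omega))
        (degree_mul_lt_of_natDegree_le hX ha (by omega)), ?_⟩⟩
    ring

open Polynomial Filter Topology in
lemma eval_nonneg_of_nonneg_toward {h : ℝ[X]} {r c : ℝ}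
    (hh : ∀ t : ℝ, 0 < t → t < 1 → 0 ≤ h.eval (r + t * (c - r))) : 0 ≤ h.eval r := by
  have hcont : Continuous fun t : ℝ => h.eval (r + t * (c - r)) := by fun_prop
  have ht : Tendsto (fun t : ℝ => h.eval (r + t * (c - r))) (𝓝[>] 0) (𝓝 (h.eval r)) := by
    have := (hcont.tendsto 0).mono_left (nhdsWithin_le_nhds (s := Set.Ioi 0))
    simpa using this
  refine ge_of_tendsto ht ?_
  filter_upwards [Ioo_mem_nhdsGT (zero_lt_one (α := ℝ))] with t h1
  exact hh t h1.1 h1.2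

open Polynomial in
/-- A polynomial that is nonnegative on `[0, 1]` away from one point is nonnegative on `[0, 1]`. -/
lemma eval_nonneg_of_nonneg_ne {h : ℝ[X]} {r : ℝ}
    (hh : ∀ x, 0 ≤ x → x ≤ 1 → x ≠ r → 0 ≤ h.eval x) {x : ℝ} (h0 : 0 ≤ x) (h1 : x ≤ 1) :
    0 ≤ h.eval x := by
  by_cases hx : x = r
  · obtain ⟨c, hc0, hc1, hc⟩ : ∃ c : ℝ, 0 ≤ c ∧ c ≤ 1 ∧ c ≠ x := by
      by_cases h : x = 0
      · exact ⟨1, zero_le_one, le_rfl, by rw [h]; exact one_ne_zero⟩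
      · exact ⟨0, le_rfl, zero_le_one, Ne.symm h⟩
    refine eval_nonneg_of_nonneg_toward (c := c) fun t ht0 ht1 => hh _ ?_ ?_ ?_
    · nlinarith
    · nlinarith
    · rw [← hx]
      intro h
      have : t * (c - x) = 0 := by linarith
      rcases mul_eq_zero.1 this with h | h
      · exact ht0.ne' h
      · exact hc (by linarith)
  · exact hh x h0 h1 hx

open Polynomial in
/-- **Lukács' theorem**: a polynomial that is nonnegative on `[0, 1]` has a certificate. The factors
belonging to its complex roots are split off one after the other; a root in the interior of the
interval is at least double. -/
theorem hasLukacsForm_of_nonneg {f : ℝ[X]} {N : ℕ} (hN : f.natDegree ≤ N)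
    (hf : ∀ x, 0 ≤ x → x ≤ 1 → 0 ≤ f.eval x) : HasLukacsForm N f := by
  refine HasLukacsForm.mono (N := f.natDegree) ?_ hN
  clear hN
  induction hn : f.natDegree using Nat.strong_induction_on generalizing f with
  | _ n ih =>
  by_cases hn0 : n = 0
  · obtain ⟨c, rfl⟩ : ∃ c, f = C c := ⟨_, eq_C_of_natDegree_eq_zero (hn.trans hn0)⟩
    have hc : 0 ≤ c := by simpa using hf 0 le_rfl zero_le_one
    refine ⟨0, C (√c), 0, ?_, Or.inl ⟨by omega, by simp, ?_⟩⟩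
    · exact lt_of_le_of_lt degree_C_le (by simp)
    · rw [← C_pow, Real.sq_sqrt hc]; simp
  have hf0 : f ≠ 0 := by rintro rfl; simp at hn; omega
  obtain ⟨z, hz⟩ : ∃ z : ℂ, aeval z f = 0 :=
    IsAlgClosed.exists_aeval_eq_zero ℂ f (by
      rw [degree_eq_natDegree hf0, hn]; exact_mod_cast hn0)
  have hquad (p s : ℝ) : (X ^ 2 - C (2 * p) * X + C s : ℝ[X]).natDegree = 2 := by
    compute_degree!
  by_cases him : z.im = 0
  · obtain ⟨r, rfl⟩ : ∃ r : ℝ, z = r := ⟨z.re, by apply Complex.ext <;> simp [him]⟩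
    have hr : f.IsRoot r := by
      have h2 : ((f.eval r : ℝ) : ℂ) = 0 := by
        rw [← hz, ← Complex.coe_algebraMap, aeval_algebraMap_apply]; simp
      exact_mod_cast h2
    obtain ⟨g, hg⟩ := dvd_iff_isRoot.2 hr
    have hg0 : g ≠ 0 := by rintro rfl; simp [hf0] at hg
    have hgd : f.natDegree = 1 + g.natDegree := by
      rw [hg, natDegree_mul (X_sub_C_ne_zero r) hg0, natDegree_X_sub_C]
    have hev (x : ℝ) : f.eval x = (x - r) * g.eval x := by rw [hg]; simp
    rcases le_or_gt r 0 with hr0 | hr0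
    · have key := ih g.natDegree (by omega) (f := g) (fun x hx0 hx1 =>
        eval_nonneg_of_nonneg_ne (r := r) (fun y hy0 hy1 hy => by
          have h1 := hf y hy0 hy1
          rw [hev] at h1
          have h2 : 0 < y - r := lt_of_le_of_ne (by linarith) (fun h => hy (by linarith))
          exact nonneg_of_mul_nonneg_right h1 h2) hx0 hx1) rfl
      have := key.linear_mul (u := 1 - r) (v := -r) (by linarith) (by linarith)
      convert this using 1
      · omega
      · rw [hg]; congr 1; simp; ring
    rcases le_or_gt 1 r with hr1 | hr1
    · have key := ih g.natDegree (by omega) (f := -g) (fun x hx0 hx1 =>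
        eval_nonneg_of_nonneg_ne (r := r) (fun y hy0 hy1 hy => by
          have h1 := hf y hy0 hy1
          rw [hev] at h1
          have h2 : 0 < r - y := lt_of_le_of_ne (by linarith) (fun h => hy (by linarith))
          refine (mul_nonneg_iff_of_pos_left h2).1 ?_
          rw [eval_neg]; linarith) hx0 hx1) (by simp)
      have := key.linear_mul (u := r - 1) (v := r) (by linarith) (by linarith)
      convert this using 1
      · omega
      · rw [hg, mul_neg, ← neg_mul]; congr 1; simp; ring
    -- `f` does not change sign at the interior root `r`, so the cofactor `g` vanishes there.
    have hgr : g.IsRoot r := by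
      refine le_antisymm ?_ ?_
      · have : 0 ≤ (-g).eval r := eval_nonneg_of_nonneg_toward (c := 0) fun t ht0 ht1 => by
          have h1 := hf (r + t * (0 - r)) (by nlinarith) (by nlinarith)
          rw [hev] at h1
          refine (mul_nonneg_iff_of_pos_left (mul_pos ht0 hr0)).1 ?_
          rw [eval_neg]; linarith
        simpa using this
      · refine eval_nonneg_of_nonneg_toward (c := 1) fun t ht0 ht1 => ?_
        have h1 := hf (r + t * (1 - r)) (by nlinarith) (by nlinarith)
        rw [hev] at h1
        refine (mul_nonneg_iff_of_pos_left (mul_pos ht0 (sub_pos.2 hr1))).1 ?_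
        linarith
    obtain ⟨h, hh⟩ := dvd_iff_isRoot.2 hgr
    have hh0 : h ≠ 0 := by rintro rfl; simp [hg0] at hh
    have hhd : g.natDegree = 1 + h.natDegree := by
      rw [hh, natDegree_mul (X_sub_C_ne_zero r) hh0, natDegree_X_sub_C]
    have hev2 (x : ℝ) : f.eval x = (x - r) ^ 2 * h.eval x := by rw [hev, hh]; simp; ring
    have key := ih h.natDegree (by omega) (f := h) (fun x hx0 hx1 =>
        eval_nonneg_of_nonneg_ne (r := r) (fun y hy0 hy1 hy => by
          have h1 := hf y hy0 hy1
          rw [hev2] at h1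
          have h2 : 0 < (y - r) ^ 2 := by
            have := sub_ne_zero.2 hy
            positivity
          exact nonneg_of_mul_nonneg_right h1 h2) hx0 hx1) rfl
    have := key.quadratic_mul (p := r) (s := r ^ 2) le_rfl
    convert this using 1
    · omega
    · rw [hg, hh]; simp [map_ofNat C 2]; ring
  · obtain ⟨g, hg⟩ := f.quadratic_dvd_of_aeval_eq_zero_im_ne_zero hz him
    have hs : z.re ^ 2 < ‖z‖ ^ 2 := by
      rw [← Complex.normSq_eq_norm_sq, Complex.normSq_apply]
      have : 0 < z.im * z.im := mul_self_pos.2 him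
      nlinarith
    have hg0 : g ≠ 0 := by rintro rfl; simp [hf0] at hg
    have hgd : f.natDegree = 2 + g.natDegree := by
      conv_lhs => rw [hg]
      rw [natDegree_mul (fun h => by have := hquad z.re (‖z‖ ^ 2); rw [h] at this; simp at this) hg0,
        hquad]
    have key := ih g.natDegree (by omega) (f := g) (fun x hx0 hx1 => by
        have h1 := hf x hx0 hx1
        rw [hg, eval_mul] at h1
        refine nonneg_of_mul_nonneg_right h1 ?_
        simp
        nlinarith [sq_nonneg (x - z.re)]) rfl
    have := key.quadratic_mul hs.le
    rw [← hg] at this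
    convert this using 1
    omega

/-! ### Quantum signal processing: polynomials and phases -/

open Polynomial in
/-- The pair of polynomials generated by a sequence of phases: each round applies the involution
`(p, q) ↦ (x p + (1 - x²) q, p - x q)` followed by the phases `(exp (i φ), exp (-i φ))`. -/
noncomputable def qspPair (φ : ℕ → ℝ) : ℕ → ℂ[X] × ℂ[X]
  | 0 => (C (Complex.exp (φ 0 * Complex.I)), 0)
  | d + 1 =>
    (C (Complex.exp (φ (d + 1) * Complex.I)) *
        (X * (qspPair φ d).1 + (1 - X ^ 2) * (qspPair φ d).2),
      C (Complex.exp (-(φ (d + 1) * Complex.I))) * ((qspPair φ d).1 - X * (qspPair φ d).2))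

lemma qspPair_congr {φ ψ : ℕ → ℝ} {d : ℕ} (h : ∀ i ≤ d, φ i = ψ i) :
    qspPair φ d = qspPair ψ d := by
  induction d with
  | zero => simp [qspPair, h 0 le_rfl]
  | succ d ih =>
    simp only [qspPair]
    rw [ih fun i hi => h i (by omega), h (d + 1) le_rfl]

open Polynomial ComplexConjugate in
lemma qspPair_neg (φ : ℕ → ℝ) (d : ℕ) :
    qspPair (-φ) d =
      ((qspPair φ d).1.map (starRingEnd ℂ), (qspPair φ d).2.map (starRingEnd ℂ)) := by
  induction d with
  | zero => simp [qspPair, ← Complex.exp_conj]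
  | succ d ih => simp [qspPair, ih, ← Complex.exp_conj]

open Polynomial ComplexConjugate in
lemma exists_phase_mul_eq {a b : ℂ} (h : a * conj a = b * conj b) :
    ∃ φ : ℝ, Complex.exp (-(φ * Complex.I)) * a = Complex.exp (φ * Complex.I) * b := by
  have hn : ‖a‖ = ‖b‖ := by
    rw [Complex.mul_conj, Complex.mul_conj, Complex.normSq_eq_norm_sq,
      Complex.normSq_eq_norm_sq] at h
    have h' : ‖a‖ ^ 2 = ‖b‖ ^ 2 := by exact_mod_cast h
    exact (sq_eq_sq₀ (norm_nonneg _) (norm_nonneg _)).1 h'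
  by_cases hb : b = 0
  · exact ⟨0, by rw [hb, norm_zero, norm_eq_zero] at hn; simp [hn, hb]⟩
  · refine ⟨(a / b).arg / 2, ?_⟩
    have h1 : a / b = Complex.exp ((a / b).arg * Complex.I) := by
      conv_lhs => rw [← Complex.norm_mul_exp_arg_mul_I (a / b)]
      rw [norm_div, hn, div_self (norm_ne_zero_iff.2 hb)]
      simp
    have h2 : a = Complex.exp ((a / b).arg * Complex.I) * b := by
      rw [← h1, div_mul_cancel₀ _ hb]
    generalize (a / b).arg = t at h2
    rw [h2]
    rw [← mul_assoc, ← Complex.exp_add]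
    congr 2
    push_cast
    ring

open Polynomial in
/-- Every pair of polynomials with `|p|² + (1 - x²) |q|² = 1` on the real line, of degree and parity
`d` and `d - 1` respectively, is generated by `d + 1` phases: as the leading coefficients of `p` and
`q` have the same modulus, a phase can be chosen that makes them cancel when the last round is
undone. -/
theorem exists_phases_of_norm_eq_one {d : ℕ} {p q : ℂ[X]}
    (hp : ∀ k, p.coeff k ≠ 0 → ∃ j, d = k + 2 * j)
    (hq : ∀ k, q.coeff k ≠ 0 → ∃ j, d = k + 1 + 2 * j)
    (h : p * p.map (starRingEnd ℂ) + (1 - X ^ 2) * (q * q.map (starRingEnd ℂ)) = 1) :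
    ∃ φ : ℕ → ℝ, qspPair φ d = (p, q) := by
  induction d generalizing p q with
  | zero =>
    have hq0 : q = 0 := by
      ext k
      by_contra hk
      obtain ⟨j, hj⟩ := hq k hk
      omega
    have hp0 : p = C (p.coeff 0) := by
      ext k
      rcases Nat.eq_zero_or_pos k with rfl | hk
      · simp
      · rw [coeff_C_of_ne_zero hk.ne']
        by_contra hk'
        obtain ⟨j, hj⟩ := hp k hk'
        omega
    set c := p.coeff 0
    rw [hq0, hp0] at h
    have hc : c * (starRingEnd ℂ) c = 1 := by
      rw [map_C, Polynomial.map_zero, mul_zero, mul_zero, add_zero, ← C_mul, ← C_1] at h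
      exact C_injective h
    have hn : ‖c‖ = 1 := by
      rw [Complex.mul_conj, Complex.normSq_eq_norm_sq] at hc
      have h2 : ‖c‖ ^ 2 = 1 := by exact_mod_cast hc
      exact (pow_eq_one_iff_of_nonneg (norm_nonneg c) two_ne_zero).1 h2
    refine ⟨fun _ => c.arg, ?_⟩
    have := Complex.norm_mul_exp_arg_mul_I c
    rw [hn, Complex.ofReal_one, one_mul] at this
    rw [qspPair, this, hq0, ← hp0]
  | succ d ih =>
    have hpd : p.natDegree ≤ d + 1 := natDegree_le_iff_coeff_eq_zero.2 fun k hk => by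
      by_contra hk'
      obtain ⟨j, hj⟩ := hp k hk'
      omega
    have hqd : q.natDegree ≤ d := natDegree_le_iff_coeff_eq_zero.2 fun k hk => by
      by_contra hk'
      obtain ⟨j, hj⟩ := hq k hk'
      omega
    have hlead : p.coeff (d + 1) * (starRingEnd ℂ) (p.coeff (d + 1)) =
        q.coeff d * (starRingEnd ℂ) (q.coeff d) := by
      have h1 := congrArg (fun r => r.coeff (2 + (d + d))) h
      have e1 : (p * p.map (starRingEnd ℂ)).coeff (2 + (d + d)) =
          p.coeff (d + 1) * (starRingEnd ℂ) (p.coeff (d + 1)) := by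
        rw [show 2 + (d + d) = (d + 1) + (d + 1) by ring,
          coeff_mul_add_eq_of_natDegree_le hpd (natDegree_map_le.trans hpd), coeff_map]
      have hqq : (q * q.map (starRingEnd ℂ)).natDegree ≤ d + d :=
        natDegree_mul_le.trans (add_le_add hqd (natDegree_map_le.trans hqd))
      have hw : (1 - X ^ 2 : ℂ[X]).natDegree ≤ 2 := by compute_degree
      have hw2 : (1 - X ^ 2 : ℂ[X]).coeff 2 = -1 := by
        simp [coeff_one]
      have e2 : ((1 - X ^ 2) * (q * q.map (starRingEnd ℂ))).coeff (2 + (d + d)) =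
          -(q.coeff d * (starRingEnd ℂ) (q.coeff d)) := by
        rw [coeff_mul_add_eq_of_natDegree_le hw hqq, hw2,
          coeff_mul_add_eq_of_natDegree_le hqd (natDegree_map_le.trans hqd), coeff_map, neg_one_mul]
      have e3 : (1 : ℂ[X]).coeff (2 + (d + d)) = 0 := by
        rw [coeff_one, if_neg (by omega)]
      simp only [coeff_add] at h1
      rw [e1, e2, e3] at h1
      exact eq_of_sub_eq_zero (by rw [sub_eq_add_neg]; exact h1)
    obtain ⟨θ, hθ⟩ := exists_phase_mul_eq hlead
    set u := Complex.exp (θ * Complex.I) with hu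
    set v := Complex.exp (-(θ * Complex.I)) with hv
    have huv : u * v = 1 := by rw [hu, hv, ← Complex.exp_add]; simp
    have hCuv : (C u * C v : ℂ[X]) = 1 := by rw [← C_mul, huv, C_1]
    have hcu : (starRingEnd ℂ) u = v := by simp [hu, hv, ← Complex.exp_conj]
    have hcv : (starRingEnd ℂ) v = u := by rw [← hcu, Complex.conj_conj]
    set q' : ℂ[X] := C v * p - X * (C u * q) with hq'
    set p' : ℂ[X] := X * q' + C u * q with hp'
    have hsq (k : ℕ) (hk : q'.coeff k ≠ 0) : ∃ j, d = k + 1 + 2 * j := by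
      have hk1 : ∃ j, d + 1 = k + 2 * j := by
        by_cases h1 : p.coeff k = 0
        · cases k with
          | zero => simp [hq', h1] at hk
          | succ k =>
            have h2 : q.coeff k ≠ 0 := by
              intro h2
              simp [hq', h1, h2] at hk
            obtain ⟨j, hj⟩ := hq k h2
            exact ⟨j, by omega⟩
        · exact hp k h1
      obtain ⟨j, hj⟩ := hk1
      cases j with
      | zero =>
        obtain rfl : k = d + 1 := by omega
        exfalso
        apply hk
        simp [hq', hθ]
      | succ j => exact ⟨j, by omega⟩
    have hsp (k : ℕ) (hk : p'.coeff k ≠ 0) : ∃ j, d = k + 2 * j := by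
      by_cases h1 : q.coeff k = 0
      · cases k with
        | zero => simp [hp', h1] at hk
        | succ k =>
          have h2 : q'.coeff k ≠ 0 := by
            intro h2
            simp [hp', h1, h2] at hk
          obtain ⟨j, hj⟩ := hsq k h2
          exact ⟨j, by omega⟩
      · obtain ⟨j, hj⟩ := hq k h1
        exact ⟨j, by omega⟩
    have hnorm : p' * p'.map (starRingEnd ℂ) + (1 - X ^ 2) * (q' * q'.map (starRingEnd ℂ)) = 1 := by
      refine Eq.trans ?_ h
      simp only [hp', hq', Polynomial.map_add, Polynomial.map_sub, Polynomial.map_mul, map_X, map_C,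
        hcu, hcv]
      linear_combination (p * p.map (starRingEnd ℂ) +
        (1 - X ^ 2) * (q * q.map (starRingEnd ℂ))) * hCuv
    obtain ⟨φ, hφ⟩ := ih hsp hsq hnorm
    refine ⟨fun i => if i ≤ d then φ i else θ, ?_⟩
    have e := qspPair_congr (φ := fun i => if i ≤ d then φ i else θ) (ψ := φ) (d := d)
      fun i hi => if_pos hi
    simp only [qspPair, e, hφ, if_neg (show ¬ d + 1 ≤ d by omega), ← hu, ← hv]
    refine Prod.ext ?_ ?_
    · simp only [hp', hq']
      linear_combination p * hCuv
    · simp only [hp', hq']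
      linear_combination q * hCuv

open Polynomial in
/-- An even real polynomial of degree at most `2 ℓ` that is bounded by `1` on `[-1, 1]` is the real
part of a polynomial generated by phases. The imaginary part and the second component of the pair
come from a Lukács certificate for `1 - s²`. -/
theorem exists_phases_of_abs_le_one {s : ℝ[X]} {ℓ : ℕ} (hs : s.natDegree ≤ ℓ)
    (hb : ∀ y, 0 ≤ y → y ≤ 1 → |s.eval y| ≤ 1) :
    ∃ φ : ℕ → ℝ, (qspPair φ (2 * ℓ)).1 + (qspPair (-φ) (2 * ℓ)).1 =
      2 * (s.comp (X ^ 2)).map (algebraMap ℝ ℂ) := by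
  have hdeg : (1 - s ^ 2).natDegree ≤ 2 * ℓ := by
    refine (natDegree_sub_le _ _).trans (max_le (by simp) ?_)
    exact natDegree_pow_le.trans (by gcongr)
  obtain ⟨k, a, b, ha, ⟨hk, hbd, hab⟩ | ⟨hk, -⟩⟩ := hasLukacsForm_of_nonneg hdeg
    (fun y h0 h1 => by
      have := hb y h0 h1
      rw [← sq_le_one_iff_abs_le_one] at this
      simpa using this)
  swap
  · omega
  obtain rfl : k = ℓ := by omega
  have had : ∀ i, a.coeff i ≠ 0 → i ≤ k := fun i hi => by
    by_contra h
    exact hi (coeff_eq_zero_of_degree_lt (ha.trans_le (by exact_mod_cast (by omega))))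
  have hsd : ∀ i, s.coeff i ≠ 0 → i ≤ k := fun i hi => (le_natDegree_of_ne_zero hi).trans hs
  have hbd' : ∀ i, b.coeff i ≠ 0 → i + 1 ≤ k := fun i hi => by
    by_contra h
    exact hi (coeff_eq_zero_of_degree_lt (hbd.trans_le (by exact_mod_cast (by omega))))
  set S : ℂ[X] := (s.comp (X ^ 2)).map (algebraMap ℝ ℂ) with hS
  set A : ℂ[X] := (a.comp (X ^ 2)).map (algebraMap ℝ ℂ) with hA
  set B : ℂ[X] := (b.comp (X ^ 2)).map (algebraMap ℝ ℂ) with hB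
  have hconj (r : ℝ[X]) : (r.map (algebraMap ℝ ℂ)).map (starRingEnd ℂ) = r.map (algebraMap ℝ ℂ) := by
    ext i; simp
  have hid : S ^ 2 + A ^ 2 + (1 - X ^ 2) * (X * B) ^ 2 = 1 := by
    have h1 := congrArg (fun r : ℝ[X] => (r.comp (X ^ 2)).map (algebraMap ℝ ℂ)) hab
    simp only [sub_comp, one_comp, pow_comp, add_comp, mul_comp, X_comp, Polynomial.map_sub,
      Polynomial.map_one, Polynomial.map_pow, Polynomial.map_add, Polynomial.map_mul, map_X] at h1
    rw [← hS, ← hA, ← hB] at h1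
    linear_combination -h1
  have hcoeff (r : ℝ[X]) (i : ℕ) (hi : ((r.comp (X ^ 2)).map (algebraMap ℝ ℂ)).coeff i ≠ 0) :
      ∃ j, i = 2 * j ∧ r.coeff j ≠ 0 := by
    rw [coeff_map, ← expand_eq_comp_X_pow, coeff_expand two_pos] at hi
    by_cases h2 : 2 ∣ i
    · obtain ⟨j, rfl⟩ := h2
      refine ⟨j, rfl, fun h => hi ?_⟩
      simp [h]
    · simp [h2] at hi
  obtain ⟨φ, hφ⟩ := exists_phases_of_norm_eq_one (d := 2 * k) (p := S + C Complex.I * A)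
    (q := X * B) (fun i hi => by
      have h1 : S.coeff i ≠ 0 ∨ A.coeff i ≠ 0 := by
        by_contra h
        push Not at h
        simp [h] at hi
      rcases h1 with h1 | h1
      · obtain ⟨j, rfl, hj⟩ := hcoeff _ _ h1
        have := hsd j hj
        exact ⟨k - j, by omega⟩
      · obtain ⟨j, rfl, hj⟩ := hcoeff _ _ h1
        have := had j hj
        exact ⟨k - j, by omega⟩)
    (fun i hi => by
      cases i with
      | zero => simp at hi
      | succ i =>
        rw [coeff_X_mul] at hi
        obtain ⟨j, rfl, hj⟩ := hcoeff _ _ hi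
        have := hbd' j hj
        exact ⟨k - (j + 1), by omega⟩)
    (by
      have hI : (C Complex.I * C Complex.I : ℂ[X]) = -1 := by
        rw [← C_mul, Complex.I_mul_I]; simp
      simp only [Polynomial.map_add, Polynomial.map_mul, map_C, map_X, hS, hA, hB, hconj,
        Complex.conj_I, C_neg]
      rw [← hS, ← hA, ← hB]
      linear_combination hid - A ^ 2 * hI)
  refine ⟨φ, ?_⟩
  rw [qspPair_neg, hφ]
  simp only [Polynomial.map_add, Polynomial.map_mul, map_C, hS, hA, hconj, Complex.conj_I, C_neg]
  ring

/-! ### The filtering polynomials on `[-1, 1]` -/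

open Polynomial in
lemma chebFilter_eval (ℓ : ℕ) (δ x : ℝ) :
    (chebFilter ℓ δ).eval x =
      ((ℓ : ℤ).negOnePow : ℝ) *
        (Chebyshev.T ℝ (ℓ : ℤ)).eval (1 - 2 * (x ^ 2 - δ ^ 2) / (1 - δ ^ 2)) := by
  rw [← Chebyshev.T_eval_neg]
  simp only [chebFilter, eval_comp, eval_add, eval_neg, eval_one, eval_mul, eval_C, eval_sub,
    eval_pow, eval_X]
  congr 1
  ring

/-- The uniform bound for the filtering polynomial outside the gap, which is the inverse of the
value of the Chebyshev polynomial at the image of the origin. -/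
noncomputable def filterBound (ℓ : ℕ) (δ : ℝ) : ℝ :=
  ((Polynomial.Chebyshev.T ℝ (ℓ : ℤ)).eval ((1 + δ ^ 2) / (1 - δ ^ 2)))⁻¹

section

variable {ℓ : ℕ} {δ : ℝ}

lemma one_sub_sq_pos (h0 : 0 < δ) (h1 : δ < 1) : 0 < 1 - δ ^ 2 := by nlinarith

lemma one_le_eval_T_filter (h0 : 0 < δ) (h1 : δ < 1) :
    1 ≤ (Polynomial.Chebyshev.T ℝ (ℓ : ℤ)).eval ((1 + δ ^ 2) / (1 - δ ^ 2)) := by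
  apply Polynomial.Chebyshev.one_le_eval_T_real
  rw [le_div_iff₀ (one_sub_sq_pos h0 h1)]
  nlinarith

lemma filterBound_pos (h0 : 0 < δ) (h1 : δ < 1) : 0 < filterBound ℓ δ :=
  inv_pos.2 (zero_lt_one.trans_le (one_le_eval_T_filter h0 h1))

lemma filterBound_le_one (h0 : 0 < δ) (h1 : δ < 1) : filterBound ℓ δ ≤ 1 :=
  inv_le_one_of_one_le₀ (one_le_eval_T_filter h0 h1)

lemma filterPoly_eval (h0 : 0 < δ) (h1 : δ < 1) (x : ℝ) :
    (filterPoly ℓ δ).eval x = filterBound ℓ δ *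
      (Polynomial.Chebyshev.T ℝ (ℓ : ℤ)).eval (1 - 2 * (x ^ 2 - δ ^ 2) / (1 - δ ^ 2)) := by
  have hpos := one_sub_sq_pos h0 h1
  have e : 1 - 2 * ((0 : ℝ) ^ 2 - δ ^ 2) / (1 - δ ^ 2) = (1 + δ ^ 2) / (1 - δ ^ 2) := by
    field_simp
    ring
  rw [filterPoly, Polynomial.eval_mul, Polynomial.eval_C, chebFilter_eval, chebFilter_eval, e,
    filterBound, mul_inv, mul_mul_mul_comm]
  rcases Int.even_or_odd (ℓ : ℤ) with h | h
  · simp [Int.negOnePow_even _ h]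
  · simp [Int.negOnePow_odd _ h]

lemma filterPoly_eval_zero (h0 : 0 < δ) (h1 : δ < 1) : (filterPoly ℓ δ).eval 0 = 1 := by
  have hpos := one_sub_sq_pos h0 h1
  have e : 1 - 2 * ((0 : ℝ) ^ 2 - δ ^ 2) / (1 - δ ^ 2) = (1 + δ ^ 2) / (1 - δ ^ 2) := by
    field_simp
    ring
  rw [filterPoly_eval h0 h1, e]
  exact inv_mul_cancel₀ (zero_lt_one.trans_le (one_le_eval_T_filter h0 h1)).ne'

/-- Outside the gap the argument of the Chebyshev polynomial lies in `[-1, 1]`. -/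
lemma abs_filterPoly_eval_le (h0 : 0 < δ) (h1 : δ < 1) {x : ℝ} (hx0 : δ ≤ |x|) (hx1 : |x| ≤ 1) :
    |(filterPoly ℓ δ).eval x| ≤ filterBound ℓ δ := by
  have hpos := one_sub_sq_pos h0 h1
  rw [filterPoly_eval h0 h1, abs_mul, abs_of_pos (filterBound_pos h0 h1)]
  refine mul_le_of_le_one_right (filterBound_pos h0 h1).le
    (Polynomial.Chebyshev.abs_eval_T_real_le_one _ ?_)
  have hx2 : δ ^ 2 ≤ x ^ 2 := by rw [← sq_abs x]; gcongr
  have hx3 : x ^ 2 ≤ 1 := (sq_le_one_iff_abs_le_one x).2 hx1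
  have a1 : 0 ≤ 2 * (x ^ 2 - δ ^ 2) / (1 - δ ^ 2) := by
    apply div_nonneg _ hpos.le
    linarith
  have a2 : 2 * (x ^ 2 - δ ^ 2) / (1 - δ ^ 2) ≤ 2 := by
    rw [div_le_iff₀ hpos]
    linarith
  rw [abs_le]
  constructor <;> linarith

lemma eval_T_le_eval_T {u v : ℝ} (hu : 1 ≤ u) (huv : u ≤ v) :
    (Polynomial.Chebyshev.T ℝ (ℓ : ℤ)).eval u ≤ (Polynomial.Chebyshev.T ℝ (ℓ : ℤ)).eval v := by
  rw [← Real.cosh_arcosh hu, ← Real.cosh_arcosh (hu.trans huv), Polynomial.Chebyshev.T_real_cosh,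
    Polynomial.Chebyshev.T_real_cosh, Real.cosh_le_cosh, abs_mul, abs_mul]
  refine mul_le_mul_of_nonneg_left ?_ (abs_nonneg _)
  rw [← Real.cosh_le_cosh, Real.cosh_arcosh hu, Real.cosh_arcosh (hu.trans huv)]
  exact huv

lemma filterPoly_eval_mem (h0 : 0 < δ) (h1 : δ < 1) {x : ℝ} (hx1 : |x| ≤ 1) :
    -filterBound ℓ δ ≤ (filterPoly ℓ δ).eval x ∧ (filterPoly ℓ δ).eval x ≤ 1 := by
  rcases le_total δ |x| with hx | hx
  · have h := abs_le.1 (abs_filterPoly_eval_le (ℓ := ℓ) h0 h1 hx hx1)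
    exact ⟨h.1, h.2.trans (filterBound_le_one h0 h1)⟩
  · have hpos := one_sub_sq_pos h0 h1
    have hx2 : x ^ 2 ≤ δ ^ 2 := by rw [← sq_abs x]; gcongr
    have hu : 1 ≤ 1 - 2 * (x ^ 2 - δ ^ 2) / (1 - δ ^ 2) := by
      have : 2 * (x ^ 2 - δ ^ 2) / (1 - δ ^ 2) ≤ 0 :=
        div_nonpos_of_nonpos_of_nonneg (by linarith) hpos.le
      linarith
    have huv : 1 - 2 * (x ^ 2 - δ ^ 2) / (1 - δ ^ 2) ≤ (1 + δ ^ 2) / (1 - δ ^ 2) := by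
      rw [le_div_iff₀ hpos, sub_mul, div_mul_cancel₀ _ hpos.ne']
      nlinarith [sq_nonneg x]
    have hκ := filterBound_pos (ℓ := ℓ) h0 h1
    rw [filterPoly_eval h0 h1]
    constructor
    · have := Polynomial.Chebyshev.one_le_eval_T_real (ℓ : ℤ) hu
      nlinarith [mul_nonneg hκ.le (zero_le_one.trans this)]
    · rw [filterBound, inv_mul_le_iff₀ (zero_lt_one.trans_le (one_le_eval_T_filter h0 h1)), mul_one]
      exact eval_T_le_eval_T hu huv

/-- The point `(1 + δ²) / (1 - δ²)` is `cosh (log ((1 + δ) / (1 - δ)))`, so that the Chebyshev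
polynomial grows exponentially in `ℓ δ` there. -/
lemma filterBound_le_exp (h0 : 0 < δ) (h1 : δ < 1) :
    filterBound ℓ δ ≤ 2 * Real.exp (-(ℓ * δ)) := by
  have hpos := one_sub_sq_pos h0 h1
  have ha : 0 < 1 + δ := by linarith
  have hb : 0 < 1 - δ := by linarith
  set s := Real.log ((1 + δ) / (1 - δ)) with hs
  have hexp : Real.exp s = (1 + δ) / (1 - δ) := Real.exp_log (by positivity)
  have hcosh : Real.cosh s = (1 + δ ^ 2) / (1 - δ ^ 2) := by
    rw [Real.cosh_eq, Real.exp_neg, hexp, show 1 - δ ^ 2 = (1 + δ) * (1 - δ) by ring]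
    field_simp
    ring
  have hsδ : δ ≤ s := by
    rw [hs, Real.log_div ha.ne' hb.ne']
    have e1 := Real.log_le_sub_one_of_pos hb
    have e2 := Real.log_nonneg (show 1 ≤ 1 + δ by linarith)
    linarith
  rw [filterBound, ← hcosh, Polynomial.Chebyshev.T_real_cosh]
  have h2 : Real.exp (ℓ * δ) / 2 ≤ Real.cosh ((ℓ : ℤ) * s) := by
    rw [Real.cosh_eq]
    have e1 : Real.exp (ℓ * δ) ≤ Real.exp ((ℓ : ℤ) * s) := by
      apply Real.exp_le_exp.2
      push_cast
      gcongr
    have e2 := Real.exp_pos (-((ℓ : ℤ) * s))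
    linarith
  calc (Real.cosh ((ℓ : ℤ) * s))⁻¹ ≤ (Real.exp (ℓ * δ) / 2)⁻¹ := by
        gcongr
    _ = 2 * Real.exp (-(ℓ * δ)) := by rw [Real.exp_neg, inv_div]; rfl

/-- The normalising factor `max_{y ∈ [-1, 1]} |2 R_ℓ(y; δ) - 1|` of the reflection polynomial. -/
noncomputable def filterMax (ℓ : ℕ) (δ : ℝ) : ℝ :=
  sSup ((fun y : ℝ => |2 * (filterPoly ℓ δ).eval y - 1|) '' Set.Icc (-1) 1)

lemma abs_two_mul_filterPoly_sub_one_le (h0 : 0 < δ) (h1 : δ < 1) {x : ℝ} (hx1 : |x| ≤ 1) :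
    |2 * (filterPoly ℓ δ).eval x - 1| ≤ 1 + 2 * filterBound ℓ δ := by
  have h := filterPoly_eval_mem (ℓ := ℓ) h0 h1 hx1
  have hκ := filterBound_pos (ℓ := ℓ) h0 h1
  rw [abs_le]
  constructor <;> linarith

lemma abs_le_filterMax (h0 : 0 < δ) (h1 : δ < 1) {x : ℝ} (hx : |x| ≤ 1) :
    |2 * (filterPoly ℓ δ).eval x - 1| ≤ filterMax ℓ δ := by
  refine le_csSup ⟨1 + 2 * filterBound ℓ δ, ?_⟩ ⟨x, abs_le.1 hx, rfl⟩
  rintro _ ⟨y, hy, rfl⟩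
  exact abs_two_mul_filterPoly_sub_one_le h0 h1 (abs_le.2 hy)

lemma one_le_filterMax (h0 : 0 < δ) (h1 : δ < 1) : 1 ≤ filterMax ℓ δ := by
  have := abs_le_filterMax (ℓ := ℓ) h0 h1 (x := 0) (by simp)
  rw [filterPoly_eval_zero h0 h1] at this
  norm_num at this
  exact this

lemma filterMax_le (h0 : 0 < δ) (h1 : δ < 1) : filterMax ℓ δ ≤ 1 + 2 * filterBound ℓ δ := by
  refine csSup_le ⟨_, 0, by simp, rfl⟩ ?_
  rintro _ ⟨y, hy, rfl⟩
  exact abs_two_mul_filterPoly_sub_one_le h0 h1 (abs_le.2 hy)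

lemma reflectionPoly_eval (x : ℝ) :
    (reflectionPoly ℓ δ).eval x = (filterMax ℓ δ)⁻¹ * (2 * (filterPoly ℓ δ).eval x - 1) := by
  simp [reflectionPoly, filterMax]

lemma abs_reflectionPoly_eval_le_one (h0 : 0 < δ) (h1 : δ < 1) {x : ℝ} (hx : |x| ≤ 1) :
    |(reflectionPoly ℓ δ).eval x| ≤ 1 := by
  have hM := one_le_filterMax (ℓ := ℓ) h0 h1
  rw [reflectionPoly_eval, abs_mul, abs_inv, abs_of_pos (zero_lt_one.trans_le hM),
    inv_mul_le_iff₀ (zero_lt_one.trans_le hM), mul_one]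
  exact abs_le_filterMax h0 h1 hx

lemma abs_reflectionPoly_eval_zero_sub_one_le (h0 : 0 < δ) (h1 : δ < 1) :
    |(reflectionPoly ℓ δ).eval 0 - 1| ≤ 4 * filterBound ℓ δ := by
  have hM := one_le_filterMax (ℓ := ℓ) h0 h1
  have hM' := filterMax_le (ℓ := ℓ) h0 h1
  have hM0 : 0 < filterMax ℓ δ := by linarith
  have hκ := filterBound_pos (ℓ := ℓ) h0 h1
  rw [reflectionPoly_eval, filterPoly_eval_zero h0 h1]
  have e : (filterMax ℓ δ)⁻¹ * (2 * 1 - 1) - 1 = (1 - filterMax ℓ δ) / filterMax ℓ δ := by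
    field_simp
    ring
  rw [e, abs_div, abs_of_pos hM0, div_le_iff₀ hM0, abs_le]
  constructor <;> nlinarith

lemma abs_reflectionPoly_eval_add_one_le (h0 : 0 < δ) (h1 : δ < 1) {x : ℝ} (hx0 : δ ≤ |x|)
    (hx1 : |x| ≤ 1) : |(reflectionPoly ℓ δ).eval x + 1| ≤ 4 * filterBound ℓ δ := by
  have hM := one_le_filterMax (ℓ := ℓ) h0 h1
  have hM' := filterMax_le (ℓ := ℓ) h0 h1
  have hM0 : 0 < filterMax ℓ δ := by linarith
  have hκ := filterBound_pos (ℓ := ℓ) h0 h1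
  have hR := abs_le.1 (abs_filterPoly_eval_le (ℓ := ℓ) h0 h1 hx0 hx1)
  rw [reflectionPoly_eval]
  have e : (filterMax ℓ δ)⁻¹ * (2 * (filterPoly ℓ δ).eval x - 1) + 1 =
      (2 * (filterPoly ℓ δ).eval x - 1 + filterMax ℓ δ) / filterMax ℓ δ := by
    field_simp
  rw [e, abs_div, abs_of_pos hM0, div_le_iff₀ hM0, abs_le]
  constructor <;> nlinarith

end

open Polynomial in
/-- The reflection polynomial is a polynomial of degree at most `ℓ` in `x²`. -/
lemma exists_reflectionPoly_eq_comp (ℓ : ℕ) (δ : ℝ) :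
    ∃ s : ℝ[X], s.natDegree ≤ ℓ ∧ reflectionPoly ℓ δ = s.comp (X ^ 2) := by
  set t : ℝ[X] := (Chebyshev.T ℝ (ℓ : ℤ)).comp (-1 + C (2 / (1 - δ ^ 2)) * (X - C (δ ^ 2)))
    with ht
  have htd : t.natDegree ≤ ℓ := by
    have h1 : (-1 + C (2 / (1 - δ ^ 2)) * (X - C (δ ^ 2)) : ℝ[X]).natDegree ≤ 1 := by
      compute_degree
    refine natDegree_comp_le.trans ?_
    rw [Chebyshev.natDegree_T]
    simpa using Nat.mul_le_mul_left ℓ h1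
  refine ⟨C (filterMax ℓ δ)⁻¹ * (2 * (C ((chebFilter ℓ δ).eval 0)⁻¹ * t) - 1), ?_, ?_⟩
  · refine (natDegree_C_mul_le _ _).trans ((natDegree_sub_le _ _).trans (max_le ?_ (by simp)))
    rw [show (2 : ℝ[X]) = C 2 from (map_ofNat C 2).symm]
    exact (natDegree_C_mul_le _ _).trans ((natDegree_C_mul_le _ _).trans htd)
  · have e : chebFilter ℓ δ = t.comp (X ^ 2) := by
      rw [ht, comp_assoc, chebFilter]
      simp
    have e2 : (filterPoly ℓ δ) = (C ((chebFilter ℓ δ).eval 0)⁻¹ * t).comp (X ^ 2) := by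
      rw [filterPoly]
      conv_lhs => rw [e]
      rw [e]
      simp
    rw [reflectionPoly, ← filterMax, e2]
    simp

lemma reflectionPoly_zero (δ : ℝ) : reflectionPoly 0 δ = 1 := by
  have h : filterPoly 0 δ = 1 := by simp [filterPoly, chebFilter]
  have hs : ((fun _ : ℝ => |(2 : ℝ) * 1 - 1|) '' Set.Icc (-1) 1) = {1} := by
    rw [Set.Nonempty.image_const (by simp)]
    norm_num
  simp only [reflectionPoly, h, Polynomial.eval_one, hs, csSup_singleton]
  norm_num

/-! ### Inclusions of basis states -/

section

variable {I J K : Type} [Fintype I] [Fintype J] [DecidableEq J]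

/-- The operator that sends the basis state `i` to the basis state `f i`. -/
def basisMap (f : I → J) : Matrix J I ℂ := Matrix.of fun x i => if x = f i then 1 else 0

omit [Fintype I] in
lemma mul_basisMap (M : Matrix K J ℂ) (f : I → J) : M * basisMap f = M.submatrix id f := by
  ext x i
  simp [basisMap, Matrix.mul_apply]

omit [Fintype I] in
lemma basisMap_conjTranspose_mul (M : Matrix J K ℂ) (f : I → J) :
    (basisMap f).conjTranspose * M = M.submatrix f id := by
  ext x i
  simp [basisMap, Matrix.mul_apply, apply_ite]

omit [Fintype I] in
lemma basisMap_conjTranspose_mul_self [DecidableEq I] {f : I → J} (hf : f.Injective) :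
    (basisMap f).conjTranspose * basisMap f = 1 := by
  rw [basisMap_conjTranspose_mul]
  ext i j
  simp [basisMap, Matrix.one_apply, hf.eq_iff]

end

/-! ### Spectral calculus of the encoded operator -/

section

variable {n : ℕ}

lemma isEigenvalue_iff {H : Op (Fin n)} {μ : ℝ} :
    IsEigenvalue H μ ↔ ∃ v : Basis (Fin n) → ℂ, v ≠ 0 ∧ H.mulVec v = (μ : ℂ) • v := by
  constructor
  · intro h
    obtain ⟨v, hv⟩ := Module.End.HasEigenvalue.exists_hasEigenvector h
    refine ⟨WithLp.ofLp v, fun h0 => hv.2 ?_, ?_⟩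
    · ext i; simp [h0]
    · exact congrArg WithLp.ofLp hv.apply_eq_smul
  · rintro ⟨v, hv0, hv⟩
    refine Module.End.hasEigenvalue_of_hasEigenvector (x := WithLp.toLp 2 v) ⟨?_, ?_⟩
    · rw [Module.End.mem_eigenspace_iff, Matrix.toLpLin_apply]
      exact congrArg (WithLp.toLp 2) hv
    · exact fun h => hv0 (congrArg WithLp.ofLp h)

open scoped Matrix.Norms.L2Operator in
lemma eq_smul_zeroBlock {m : ℕ} {α : ℝ} {H : Op (Fin n)} {U : Op (Reg m n)}
    (hU : IsBlockEncoding α m 0 U H) : H = (α : ℂ) • zeroBlock U :=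
  sub_eq_zero.1 (norm_eq_zero.1 (le_antisymm hU.2 (norm_nonneg _)))

open scoped Matrix.Norms.L2Operator in
/-- The eigenvalues of a block-encoded operator are bounded by the normalisation. -/
lemma abs_le_of_isEigenvalue {m : ℕ} {α μ : ℝ} {H : Op (Fin n)} {U : Op (Reg m n)} (hα : 0 < α)
    (hU : IsBlockEncoding α m 0 U H) (hμ : IsEigenvalue H μ) : |μ| ≤ α := by
  set J : Matrix (Basis (Reg m n)) (Basis (Fin n)) ℂ :=
    basisMap fun j : Basis (Fin n) => (Sum.elim 0 j : Basis (Reg m n)) with hJ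
  have hJJ : J.conjTranspose * J = 1 := basisMap_conjTranspose_mul_self fun i j h => by
    funext k
    exact congrFun h (Sum.inr k)
  have hJn : ‖J‖ ≤ 1 := by
    have h1 : ‖J‖ * ‖J‖ = 1 := by
      rw [← Matrix.l2_opNorm_conjTranspose_mul_self, hJJ]
      exact norm_one
    nlinarith [norm_nonneg J]
  have hUn : ‖U‖ ≤ 1 := by
    have h1 : ‖U‖ * ‖U‖ = 1 := by
      rw [← Matrix.l2_opNorm_conjTranspose_mul_self]
      rw [show U.conjTranspose * U = 1 from Matrix.mem_unitaryGroup_iff'.1 hU.1]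
      exact norm_one
    nlinarith [norm_nonneg U]
  have hz : zeroBlock U = J.conjTranspose * (U * J) := by
    rw [hJ, mul_basisMap, basisMap_conjTranspose_mul]
    rfl
  have hzn : ‖zeroBlock U‖ ≤ 1 := by
    rw [hz]
    refine (Matrix.l2_opNorm_mul _ _).trans ?_
    rw [Matrix.l2_opNorm_conjTranspose]
    have := Matrix.l2_opNorm_mul U J
    nlinarith [norm_nonneg J, norm_nonneg U, norm_nonneg (U * J)]
  obtain ⟨v, hv0, hv⟩ := isEigenvalue_iff.1 hμ
  have h1 := Matrix.l2_opNorm_mulVec H (WithLp.toLp 2 v)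
  have h2 : ‖H‖ ≤ α := by
    rw [eq_smul_zeroBlock hU, norm_smul, Complex.norm_real, Real.norm_of_nonneg hα.le]
    nlinarith
  have h3 : (EuclideanSpace.equiv (Basis (Fin n)) ℂ).symm (H.mulVec v) =
      (μ : ℂ) • WithLp.toLp 2 v := by
    rw [hv]; rfl
  have h4 : 0 < ‖(WithLp.toLp 2 v : EuclideanSpace ℂ (Basis (Fin n)))‖ :=
    norm_pos_iff.2 fun h => hv0 (congrArg WithLp.ofLp h)
  change ‖(EuclideanSpace.equiv (Basis (Fin n)) ℂ).symm (H.mulVec v)‖ ≤ _ at h1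
  rw [h3, norm_smul, Complex.norm_real, Real.norm_eq_abs] at h1
  exact (le_of_mul_le_mul_right h1 h4).trans h2

lemma eigenprojector_eq {H E X : Op (Fin n)} {lam : ℝ} (hE : E.IsHermitian)
    (h1 : H * E = (lam : ℂ) • E) (h2 : 1 - E = X * (H - (lam : ℂ) • 1)) :
    eigenprojector H lam = E := by
  rw [eigenprojector]
  refine (Matrix.toEuclideanCLM (𝕜 := ℂ) (n := Basis (Fin n))).symm_apply_eq.2 ?_
  ext1 w
  refine Submodule.eq_starProjection_of_mem_of_inner_eq_zero ?_ ?_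
  · rw [Module.End.mem_eigenspace_iff, ← Matrix.coe_toEuclideanCLM_eq_toEuclideanLin]
    change (Matrix.toEuclideanCLM (𝕜 := ℂ) H * Matrix.toEuclideanCLM (𝕜 := ℂ) E) w = _
    rw [← map_mul, h1, map_smul]
    rfl
  · intro v hv
    have hv' : Matrix.toEuclideanCLM (𝕜 := ℂ) (1 - E) v = 0 := by
      rw [h2, map_mul, map_sub, map_smul, map_one]
      rw [Module.End.mem_eigenspace_iff, ← Matrix.coe_toEuclideanCLM_eq_toEuclideanLin] at hv
      change Matrix.toEuclideanCLM (𝕜 := ℂ) X (Matrix.toEuclideanCLM (𝕜 := ℂ) H v - (lam : ℂ) • v) = 0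
      rw [show Matrix.toEuclideanCLM (𝕜 := ℂ) H v = (lam : ℂ) • v from hv, sub_self, map_zero]
    have hw : w - Matrix.toEuclideanCLM (𝕜 := ℂ) E w =
        ContinuousLinearMap.adjoint (Matrix.toEuclideanCLM (𝕜 := ℂ) (1 - E)) w := by
      rw [← ContinuousLinearMap.star_eq_adjoint, ← map_star, star_sub, star_one,
        show star E = E from hE, map_sub, map_one]
      rfl
    rw [hw, ContinuousLinearMap.adjoint_inner_left, hv', inner_zero_right]

open Polynomial in
lemma aeval_diagonal_ofReal {I : Type} [Fintype I] [DecidableEq I] (f : ℝ[X]) (d : I → ℝ) :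
    aeval (Matrix.diagonal fun i => (d i : ℂ)) f =
      Matrix.diagonal fun i => ((f.eval (d i) : ℝ) : ℂ) := by
  have h := Polynomial.aeval_algHom_apply (Matrix.diagonalAlgHom ℝ (n := I) (α := ℂ))
    (fun i => (d i : ℂ)) f
  rw [Matrix.diagonalAlgHom_apply, Matrix.diagonalAlgHom_apply] at h
  rw [h]
  congr 1
  ext i
  rw [Polynomial.aeval_pi_apply₂]
  rw [← Complex.coe_algebraMap, aeval_algebraMap_apply]
  simp

open Polynomial in
/-- Simultaneous diagonalisation of the reflection about an eigenspace and of a polynomial in the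
shifted operator. -/
lemma exists_reflection_sub_aeval_eq_diagonal {H : Op (Fin n)} (hH : H.IsHermitian) (f : ℝ[X])
    (α lam : ℝ) :
    ∃ (V : Matrix.unitaryGroup (Basis (Fin n)) ℂ) (d : Basis (Fin n) → ℝ),
      (∀ i, IsEigenvalue H (d i)) ∧ reflection H lam - aeval (shifted H α lam) f =
        (V : Op (Fin n)) * Matrix.diagonal (fun i => (((if d i = lam then 1 else -1) -
          f.eval ((α + |lam|)⁻¹ * (d i - lam)) : ℝ) : ℂ)) * star (V : Op (Fin n)) := by
  set d := hH.eigenvalues with hd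
  have hdE (i) : IsEigenvalue H (d i) := by
    refine isEigenvalue_iff.2 ⟨⇑(hH.eigenvectorBasis i), fun h0 => ?_, ?_⟩
    · have h1 : hH.eigenvectorBasis i = 0 := by
        ext k; exact congrFun h0 k
      have := hH.eigenvectorBasis.orthonormal.1 i
      rw [h1, norm_zero] at this
      exact zero_ne_one this
    · rw [hH.mulVec_eigenvectorBasis i]
      rfl
  set V := hH.eigenvectorUnitary with hV
  set Φ := Unitary.conjStarAlgAut ℂ (Op (Fin n)) V with hΦ
  obtain ⟨D, hD⟩ : ∃ D : (ℝ → ℝ) → Op (Fin n),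
      ∀ g, D g = Matrix.diagonal fun i => ((g (d i) : ℝ) : ℂ) := ⟨_, fun _ => rfl⟩
  have hspec : H = Φ (D fun t => t) := by
    rw [hD]
    exact hH.spectral_theorem
  have hone : (1 : Op (Fin n)) = Φ (D fun _ => 1) := by
    rw [← map_one Φ]
    congr 1
    simp [hD]
  have hmul (g g' : ℝ → ℝ) : Φ (D g) * Φ (D g') = Φ (D fun t => g t * g' t) := by
    rw [← map_mul]
    simp [hD, Matrix.diagonal_mul_diagonal]
  have hsub (g g' : ℝ → ℝ) : Φ (D g) - Φ (D g') = Φ (D fun t => g t - g' t) := by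
    rw [← map_sub]
    simp [hD, Matrix.diagonal_sub]
  have hsmul (c : ℝ) (g : ℝ → ℝ) : (c : ℂ) • Φ (D g) = Φ (D fun t => c * g t) := by
    rw [← map_smul]
    congr 1
    simp only [hD]
    rw [← Matrix.diagonal_smul]
    congr 1
    ext i
    simp
  have hproj : eigenprojector H lam = Φ (D fun t => if t = lam then 1 else 0) := by
    refine eigenprojector_eq
      (X := Φ (D fun t => if t = lam then 0 else (t - lam)⁻¹)) ?_ ?_ ?_
    · change star _ = _
      rw [← map_star]
      congr 1
      simp only [hD, Matrix.star_eq_conjTranspose, Matrix.diagonal_conjTranspose]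
      congr 1
      ext i
      simp
    · conv_lhs => rw [hspec]
      rw [hmul, hsmul]
      congr 2
      funext t
      split_ifs with ht <;> simp [ht]
    · conv_rhs => rw [hspec]
      rw [hone, hsmul, hsub, hsub, hmul]
      congr 2
      funext t
      split_ifs with ht
      · simp
      · rw [mul_one, inv_mul_cancel₀ (sub_ne_zero.2 ht), sub_zero]
  have hrefl : reflection H lam = Φ (D fun t => if t = lam then 1 else -1) := by
    rw [reflection, hproj, show (2 : ℂ) = ((2 : ℝ) : ℂ) by norm_num, hsmul, hone, hsub]
    congr 2
    funext t
    split_ifs <;> norm_num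
  have hshift : shifted H α lam = Φ (D fun t => (α + |lam|)⁻¹ * (t - lam)) := by
    rw [shifted]
    conv_lhs => rw [hspec]
    rw [hone, hsmul, hsub, hsmul]
    congr 2
    funext t
    ring
  have haeval : aeval (shifted H α lam) f =
      Φ (D fun t => f.eval ((α + |lam|)⁻¹ * (t - lam))) := by
    rw [hshift]
    have h1 := Polynomial.aeval_algHom_apply
      ((Φ : Op (Fin n) →ₐ[ℂ] Op (Fin n)).restrictScalars ℝ)
      (D fun t => (α + |lam|)⁻¹ * (t - lam)) f
    have h2 := aeval_diagonal_ofReal f (fun i => (α + |lam|)⁻¹ * (d i - lam))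
    rw [hD, h2] at h1
    rw [hD, hD]
    exact h1
  refine ⟨V, d, hdE, ?_⟩
  rw [hrefl, haeval, hsub, hD, hΦ, Unitary.conjStarAlgAut_apply, ← Unitary.coe_star]

open Polynomial in
open scoped Matrix.Norms.L2Operator in
/-- If `f` is close to `1` at the image of `lam` and close to `-1` at the images of the other
eigenvalues, then `f` of the shifted operator is close to the reflection about the eigenspace. -/
lemma norm_reflection_sub_aeval_shifted_le {H : Op (Fin n)} (hH : H.IsHermitian) {f : ℝ[X]}
    {α lam ε : ℝ} (hε : 0 ≤ ε)
    (h : ∀ μ, IsEigenvalue H μ →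
      |f.eval ((α + |lam|)⁻¹ * (μ - lam)) - (if μ = lam then 1 else -1)| ≤ ε) :
    ‖reflection H lam - aeval (shifted H α lam) f‖ ≤ ε := by
  obtain ⟨V, d, hd, hV⟩ := exists_reflection_sub_aeval_eq_diagonal hH f α lam
  have e : ‖reflection H lam - aeval (shifted H α lam) f‖ = _ := congrArg norm hV
  rw [e, ← Unitary.coe_star, CStarRing.norm_mul_coe_unitary, CStarRing.norm_coe_unitary_mul,
    Matrix.l2_opNorm_diagonal, pi_norm_le_iff_of_nonneg hε]
  intro i
  rw [Complex.norm_real, Real.norm_eq_abs, abs_sub_comm]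
  exact h _ (hd i)

end

/-! ### Operators acting on part of a register -/

section

variable {K Q : Type} [Fintype K] [DecidableEq K] [Fintype Q] [DecidableEq Q]

/-- Left multiplication by `applyOn e V` sums over the new values of the qubits in the range
of `e`. -/
lemma applyOn_mul_apply {J : Type} (e : K ↪ Q) (V : Op K) (M : Matrix (Basis Q) J ℂ)
    (x : Basis Q) (y : J) :
    (applyOn e V * M) x y = ∑ w, V (fun k => x (e k)) w * M (Function.extend e w x) y := by
  classical
  rw [Matrix.mul_apply]
  symm
  refine Fintype.sum_of_injective (fun w => Function.extend e w x) ?_ _ _ ?_ ?_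
  · intro w w' h
    funext k
    have := congrFun h (e k)
    simpa only [e.injective.extend_apply] using this
  · intro z hz
    rw [applyOn, Matrix.of_apply, if_neg, zero_mul]
    intro h
    refine hz ⟨fun k => z (e k), ?_⟩
    funext q
    by_cases hq : ∃ k, e k = q
    · obtain ⟨k, rfl⟩ := hq
      exact e.injective.extend_apply _ _ _
    · push Not at hq
      rw [← h q hq]
      exact Function.extend_apply' _ _ _ (by push Not; exact hq)
  · intro w
    simp only [applyOn, Matrix.of_apply, e.injective.extend_apply]
    rw [if_pos]
    intro q hq
    exact (Function.extend_apply' _ _ _ (by push Not; exact hq)).symm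

omit [DecidableEq K] in
lemma applyOn_conjTranspose (e : K ↪ Q) (V : Op K) :
    (applyOn e V).conjTranspose = applyOn e V.conjTranspose := by
  ext x y
  simp only [applyOn, Matrix.conjTranspose_apply, Matrix.of_apply]
  by_cases h : ∀ q, (∀ k, e k ≠ q) → y q = x q
  · rw [if_pos h, if_pos fun q hq => (h q hq).symm]
  · rw [if_neg h, if_neg fun h' => h fun q hq => (h' q hq).symm, star_zero]

omit [Fintype K] [DecidableEq K] [Fintype Q] [DecidableEq Q] in
lemma extend_self (e : K ↪ Q) (y : Basis Q) : Function.extend e (fun k => y (e k)) y = y := by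
  funext q
  by_cases hq : ∃ k, e k = q
  · obtain ⟨k, rfl⟩ := hq
    exact e.injective.extend_apply _ _ _
  · exact Function.extend_apply' _ _ _ hq

lemma applyOn_mul (e : K ↪ Q) (V W : Op K) :
    applyOn e V * applyOn e W = applyOn e (V * W) := by
  ext x y
  rw [applyOn_mul_apply]
  simp only [applyOn, Matrix.of_apply, e.injective.extend_apply, Matrix.mul_apply]
  have h (w : Basis K) : (∀ q, (∀ k, e k ≠ q) → Function.extend e w x q = y q) ↔
      ∀ q, (∀ k, e k ≠ q) → x q = y q := by
    refine forall₂_congr fun q hq => ?_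
    rw [Function.extend_apply' _ _ _ (by push Not; exact hq)]
  simp only [h]
  split_ifs <;> simp

omit [DecidableEq K] in
lemma applyOn_one (e : K ↪ Q) : applyOn e (1 : Op K) = 1 := by
  ext x y
  simp only [applyOn, Matrix.of_apply, Matrix.one_apply]
  by_cases hxy : x = y
  · simp [hxy]
  · rw [if_neg hxy]
    split_ifs with h1 h2
    · exfalso
      apply hxy
      rw [← extend_self e x, ← extend_self e y, h2]
      funext q
      by_cases hq : ∃ k, e k = q
      · obtain ⟨k, rfl⟩ := hq
        simp only [e.injective.extend_apply]
      · rw [Function.extend_apply' _ _ _ hq, Function.extend_apply' _ _ _ hq]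
        exact h1 q (by push Not at hq; exact hq)
    · rfl
    · rfl

lemma applyOn_mem_unitaryGroup (e : K ↪ Q) {V : Op K}
    (hV : V ∈ Matrix.unitaryGroup (Basis K) ℂ) :
    applyOn e V ∈ Matrix.unitaryGroup (Basis Q) ℂ := by
  rw [Matrix.mem_unitaryGroup_iff] at hV ⊢
  rw [Matrix.star_eq_conjTranspose, applyOn_conjTranspose, applyOn_mul,
    ← Matrix.star_eq_conjTranspose, hV, applyOn_one]

/-- `W` does not change the value of the qubit `c`. -/
def Preserves (c : Q) (W : Op Q) : Prop := ∀ x y, W x y ≠ 0 → x c = y c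

omit [DecidableEq K] in
lemma preserves_applyOn (e : K ↪ Q) (V : Op K) {c : Q} (hc : ∀ k, e k ≠ c) :
    Preserves c (applyOn e V) := by
  intro x y h
  by_contra hxy
  exact h (if_neg fun h' => hxy (h' c hc))

lemma Preserves.mul {c : Q} {V W : Op Q} (hV : Preserves c V) (hW : Preserves c W) :
    Preserves c (V * W) := by
  intro x y h
  rw [Matrix.mul_apply] at h
  obtain ⟨z, -, hz⟩ := Finset.exists_ne_zero_of_sum_ne_zero h
  exact (hV x z (left_ne_zero_of_mul hz)).trans (hW z y (right_ne_zero_of_mul hz))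

omit [Fintype Q] [DecidableEq Q] in
lemma Preserves.conjTranspose {c : Q} {V : Op Q} (hV : Preserves c V) :
    Preserves c V.conjTranspose := by
  intro x y h
  refine (hV y x fun h0 => h ?_).symm
  rw [Matrix.conjTranspose_apply, h0, star_zero]

lemma Preserves.controlled {b : Q} {V : Op Q} (hV : Preserves b V) (c : Q) :
    Preserves b (controlled c V) := by
  intro x y h
  simp only [EigFilter.controlled, Matrix.of_apply] at h
  split_ifs at h with h1 h2
  · exact hV x y h
  · rw [h2]
  · exact absurd rfl h

lemma controlled_conjTranspose {c : Q} {W : Op Q} (hW : Preserves c W) :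
    (controlled c W).conjTranspose = controlled c W.conjTranspose := by
  ext x y
  simp only [controlled, Matrix.conjTranspose_apply, Matrix.of_apply]
  by_cases hxy : x c = y c
  · rw [hxy]
    split_ifs with h1 h2 h3 h3
    · rfl
    · exact star_one _
    · exact absurd h2.symm h3
    · exact absurd h3.symm h2
    · exact star_zero _
  · have h1 : W y x = 0 := by
      by_contra h
      exact hxy (hW y x h).symm
    have h2 : x ≠ y := fun h => hxy (by rw [h])
    simp [h1, h2, h2.symm]

lemma controlled_mul {c : Q} {V W : Op Q} (hV : Preserves c V) :
    controlled c V * controlled c W = controlled c (V * W) := by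
  ext x y
  rw [Matrix.mul_apply]
  by_cases hx : x c = 1
  · have e : ∀ z, controlled c V x z * controlled c W z y = V x z * W z y := by
      intro z
      simp only [controlled, Matrix.of_apply, if_pos hx]
      by_cases hz : V x z = 0
      · rw [hz, zero_mul, zero_mul]
      · rw [if_pos ((hV x z hz).symm.trans hx)]
    simp only [e]
    simp [controlled, hx, Matrix.mul_apply]
  · have e : ∀ z, controlled c V x z * controlled c W z y =
        if x = z then controlled c W z y else 0 := by
      intro z
      by_cases hz : x = z
      · subst hz
        simp [controlled, hx]
      · simp [controlled, hx, hz]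
    simp only [e, Finset.sum_ite_eq, Finset.mem_univ, if_true]
    simp [controlled, hx]

lemma controlled_one (c : Q) : controlled c (1 : Op Q) = 1 := by
  ext x y
  simp [controlled, Matrix.one_apply]

lemma controlled_mem_unitaryGroup {c : Q} {W : Op Q} (hc : Preserves c W)
    (hW : W ∈ Matrix.unitaryGroup (Basis Q) ℂ) :
    controlled c W ∈ Matrix.unitaryGroup (Basis Q) ℂ := by
  rw [Matrix.mem_unitaryGroup_iff] at hW ⊢
  rw [Matrix.star_eq_conjTranspose, controlled_conjTranspose hc, controlled_mul hc,
    ← Matrix.star_eq_conjTranspose, hW, controlled_one]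

end

/-! ### Circuits -/

section

variable {K Q : Type} [Fintype K] [Fintype Q] [DecidableEq Q]

lemma Circuit.eval_append (U : Op K) (c₁ c₂ : Circuit K Q) :
    Circuit.eval U (c₁ ++ c₂) = Circuit.eval U c₂ * Circuit.eval U c₁ := by
  induction c₁ with
  | nil => simp [Circuit.eval]
  | cons s c ih => simp [Circuit.eval, ih, mul_assoc]

lemma Circuit.eval_singleton (U : Op K) (s : Step K Q) : Circuit.eval U [s] = s.eval U := by
  simp [Circuit.eval]

omit [Fintype K] [Fintype Q] [DecidableEq Q] in
lemma Circuit.gates_append (c₁ c₂ : Circuit K Q) :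
    Circuit.gates (c₁ ++ c₂) = Circuit.gates c₁ + Circuit.gates c₂ := by
  simp [Circuit.gates]

omit [Fintype K] [Fintype Q] [DecidableEq Q] in
lemma Circuit.queries_append (c₁ c₂ : Circuit K Q) :
    Circuit.queries (c₁ ++ c₂) = Circuit.queries c₁ + Circuit.queries c₂ := by
  simp [Circuit.queries]

lemma oracleOp_mem_unitaryGroup [DecidableEq K] {U : Op K}
    (hU : U ∈ Matrix.unitaryGroup (Basis K) ℂ) (adj : Bool) :
    oracleOp U adj ∈ Matrix.unitaryGroup (Basis K) ℂ := by
  cases adj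
  · exact hU
  · exact Unitary.star_mem hU

lemma Circuit.eval_mem_unitaryGroup [DecidableEq K] {U : Op K}
    (hU : U ∈ Matrix.unitaryGroup (Basis K) ℂ) (c : Circuit K Q) :
    Circuit.eval U c ∈ Matrix.unitaryGroup (Basis Q) ℂ := by
  induction c with
  | nil => exact one_mem _
  | cons s c ih =>
    refine mul_mem ih ?_
    cases s with
    | gateOne V e => exact applyOn_mem_unitaryGroup e V.2
    | gateTwo V e => exact applyOn_mem_unitaryGroup e V.2
    | query adj e => exact applyOn_mem_unitaryGroup e (oracleOp_mem_unitaryGroup hU adj)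
    | controlledQuery adj e c hc =>
      exact controlled_mem_unitaryGroup (preserves_applyOn e _ hc)
        (applyOn_mem_unitaryGroup e (oracleOp_mem_unitaryGroup hU adj))

end

/-! ### Monomial operators -/

section

variable {I : Type} [DecidableEq I]

/-- The monomial operator that sends the basis state `y` to `d y` times the basis state `f y`. -/
def monomialOp (f : I → I) (d : I → ℂ) : Matrix I I ℂ :=
  Matrix.of fun x y => if x = f y then d y else 0

lemma monomialOp_mul [Fintype I] (f g : I → I) (d d' : I → ℂ) :
    monomialOp f d * monomialOp g d' = monomialOp (f ∘ g) fun y => d (g y) * d' y := by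
  ext x y
  simp [monomialOp, Matrix.mul_apply]

lemma monomialOp_id_one : monomialOp (id : I → I) (fun _ => 1) = 1 := by
  ext x y
  simp [monomialOp, Matrix.one_apply]

lemma monomialOp_mem_unitaryGroup [Fintype I] {f : I → I} (hf : f.Injective) {d : I → ℂ}
    (hd : ∀ y, ‖d y‖ = 1) : monomialOp f d ∈ Matrix.unitaryGroup I ℂ := by
  rw [Matrix.mem_unitaryGroup_iff']
  ext x y
  rw [Matrix.mul_apply]
  by_cases hxy : x = y
  · subst hxy
    simp [monomialOp, apply_ite, ← Complex.normSq_eq_conj_mul_self,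
      Complex.normSq_eq_norm_sq, hd]
  · simp [monomialOp, apply_ite, hf.eq_iff, hxy, Ne.symm hxy]

lemma applyOn_monomialOp {K Q : Type} [Fintype K] [Fintype Q] [DecidableEq Q] (e : K ↪ Q)
    (g : Basis K → Basis K) (d : Basis K → ℂ) :
    applyOn e (monomialOp g d) =
      monomialOp (fun y : Basis Q => Function.extend e (g fun k => y (e k)) y)
        (fun y => d fun k => y (e k)) := by
  ext x y
  simp only [applyOn, monomialOp, Matrix.of_apply]
  by_cases h : x = Function.extend e (g fun k => y (e k)) y
  · rw [if_pos h, if_pos, if_pos]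
    · funext k
      rw [h, e.injective.extend_apply]
    · intro q hq
      rw [h, Function.extend_apply' _ _ _ (by push Not; exact hq)]
  · rw [if_neg h]
    split_ifs with h1 h2
    · exfalso
      apply h
      funext q
      by_cases hq : ∃ k, e k = q
      · obtain ⟨k, rfl⟩ := hq
        rw [e.injective.extend_apply, ← h2]
      · rw [Function.extend_apply' _ _ _ hq]
        exact h1 q (by push Not at hq; exact hq)
    · rfl
    · rfl

end

/-! ### One- and two-qubit gates -/

section

variable {K Q : Type} [Fintype K] [Fintype Q] [DecidableEq Q]

/-- The gate acting on the qubit `q` by the `2 × 2` unitary matrix `V`. -/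
def oneQubitGate (V : Matrix.unitaryGroup (Fin 2) ℂ) (q : Q) : Step K Q :=
  .gateOne ⟨(V : Matrix (Fin 2) (Fin 2) ℂ).submatrix (fun x => x 0) (fun x => x 0), by
    have h := V.2
    rw [Matrix.mem_unitaryGroup_iff] at h ⊢
    rw [Matrix.star_eq_conjTranspose, Matrix.conjTranspose_submatrix,
      ← Matrix.star_eq_conjTranspose]
    have e := Matrix.submatrix_mul_equiv (V : Matrix (Fin 2) (Fin 2) ℂ)
      (star (V : Matrix (Fin 2) (Fin 2) ℂ)) (fun x : Basis (Fin 1) => x 0)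
      (Equiv.funUnique (Fin 1) (Fin 2)) (fun x : Basis (Fin 1) => x 0)
    refine e.trans ?_
    rw [h]
    exact Matrix.submatrix_one_equiv (Equiv.funUnique (Fin 1) (Fin 2))⟩
    ⟨fun _ => q, fun _ _ _ => Subsingleton.elim _ _⟩

lemma oneQubitGate_eval_apply (U : Op K) (V : Matrix.unitaryGroup (Fin 2) ℂ) (q : Q)
    (x y : Basis Q) :
    (oneQubitGate V q : Step K Q).eval U x y =
      if ∀ p, p ≠ q → x p = y p then (V : Matrix (Fin 2) (Fin 2) ℂ) (x q) (y q) else 0 := by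
  simp only [oneQubitGate, Step.eval, applyOn, Matrix.of_apply, Matrix.submatrix_apply]
  by_cases h : ∀ p, p ≠ q → x p = y p
  · rw [if_pos h]
    exact if_pos fun p hp => h p (hp 0).symm
  · rw [if_neg h]
    exact if_neg fun h' => h fun p hp => h' p fun _ => hp.symm

lemma oneQubitGate_eval_mul_apply {J : Type} (U : Op K) (V : Matrix.unitaryGroup (Fin 2) ℂ) (q : Q)
    (M : Matrix (Basis Q) J ℂ) (x : Basis Q) (y : J) :
    ((oneQubitGate V q : Step K Q).eval U * M) x y =
      ∑ v, (V : Matrix (Fin 2) (Fin 2) ℂ) (x q) v * M (Function.update x q v) y := by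
  rw [oneQubitGate, Step.eval, applyOn_mul_apply]
  refine Fintype.sum_equiv (Equiv.funUnique (Fin 1) (Fin 2)) _ _ fun w => ?_
  simp only [Matrix.submatrix_apply]
  congr 2
  funext p
  by_cases hp : p = q
  · subst hp
    rw [Function.update_self]
    exact Function.Injective.extend_apply (f := fun _ : Fin 1 => p)
      (fun _ _ _ => Subsingleton.elim _ _) w x 0
  · rw [Function.update_of_ne hp]
    exact Function.extend_apply' _ _ _ (by rintro ⟨k, hk⟩; exact hp hk.symm)

lemma oneQubitGate_eval_preserves (U : Op K) (V : Matrix.unitaryGroup (Fin 2) ℂ) {q b : Q}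
    (h : q ≠ b) : Preserves b ((oneQubitGate V q : Step K Q).eval U) :=
  preserves_applyOn _ _ fun _ => h

lemma oneQubitGate_eval_conjTranspose (U : Op K) (V : Matrix.unitaryGroup (Fin 2) ℂ) (q : Q) :
    ((oneQubitGate V q : Step K Q).eval U).conjTranspose =
      (oneQubitGate (star V) q : Step K Q).eval U :=
  applyOn_conjTranspose _ _

/-- The sign `1` or `-1` of a bit. -/
def bitSign (v : Fin 2) : ℝ := if v = 0 then 1 else -1

/-- The `Z` rotation `diag (exp (i θ), exp (-i θ))`. -/
noncomputable def zRotation (θ : ℝ) : Matrix.unitaryGroup (Fin 2) ℂ :=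
  ⟨monomialOp id fun v => Complex.exp ((θ * bitSign v : ℝ) * Complex.I),
    monomialOp_mem_unitaryGroup Function.injective_id fun _ => Complex.norm_exp_ofReal_mul_I _⟩

/-- The Pauli `X` matrix. -/
def pauliX : Matrix.unitaryGroup (Fin 2) ℂ :=
  ⟨monomialOp (fun v => v + 1) fun _ => 1,
    monomialOp_mem_unitaryGroup (add_left_injective 1) fun _ => norm_one⟩

lemma zRotation_eval (U : Op K) (θ : ℝ) (q : Q) :
    (oneQubitGate (zRotation θ) q : Step K Q).eval U =
      monomialOp id fun y => Complex.exp ((θ * bitSign (y q) : ℝ) * Complex.I) := by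
  ext x y
  rw [oneQubitGate_eval_apply]
  simp only [zRotation, monomialOp, Matrix.of_apply, id]
  by_cases hxy : x = y
  · simp [hxy]
  · rw [if_neg hxy]
    split_ifs with h1 h2
    · exfalso
      apply hxy
      funext p
      by_cases hp : p = q
      · rw [hp, h2]
      · exact h1 p hp
    · rfl
    · rfl

lemma pauliX_eval (U : Op K) (q : Q) :
    (oneQubitGate pauliX q : Step K Q).eval U =
      monomialOp (fun y => Function.update y q (y q + 1)) fun _ => 1 := by
  ext x y
  rw [oneQubitGate_eval_apply]
  simp only [pauliX, monomialOp, Matrix.of_apply]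
  by_cases hxy : x = Function.update y q (y q + 1)
  · rw [if_pos hxy, if_pos, if_pos]
    · rw [hxy, Function.update_self]
    · intro p hp
      rw [hxy, Function.update_of_ne hp]
  · rw [if_neg hxy]
    split_ifs with h1 h2
    · exfalso
      apply hxy
      funext p
      by_cases hp : p = q
      · rw [hp, h2, Function.update_self]
      · rw [Function.update_of_ne hp]
        exact h1 p hp
    · rfl
    · rfl

/-- The embedding of two qubits with labels `c` and `t`. -/
def pairEmbedding (c t : Q) (h : c ≠ t) : Fin 2 ↪ Q :=
  ⟨![c, t], by
    intro i j hij
    fin_cases i <;> fin_cases j <;> simp_all [h.symm]⟩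

/-- The controlled-not gate with control `c` and target `t` (empty if `c = t`). -/
def cnot (c t : Q) : Circuit K Q :=
  if h : c ≠ t then
    [.gateTwo ⟨monomialOp (fun y => ![y 0, y 1 + y 0]) fun _ => 1,
      monomialOp_mem_unitaryGroup (by decide) fun _ => norm_one⟩ (pairEmbedding c t h)]
  else []

/-- The controlled phase gate `diag (1, 1, 1, exp (i θ))` on the qubits `c` and `t` (empty if
`c = t`). -/
noncomputable def controlledPhase (θ : ℝ) (c t : Q) : Circuit K Q :=
  if h : c ≠ t then
    [.gateTwo ⟨monomialOp id
        fun y => Complex.exp ((if y 0 = 1 ∧ y 1 = 1 then θ else 0 : ℝ) * Complex.I),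
      monomialOp_mem_unitaryGroup Function.injective_id
        fun _ => Complex.norm_exp_ofReal_mul_I _⟩ (pairEmbedding c t h)]
  else []

lemma cnot_eval (U : Op K) {c t : Q} (h : c ≠ t) :
    Circuit.eval U (cnot c t : Circuit K Q) =
      monomialOp (fun y => Function.update y t (y t + y c)) fun _ => 1 := by
  rw [cnot, dif_pos h, Circuit.eval_singleton]
  simp only [Step.eval]
  rw [applyOn_monomialOp]
  congr 1
  funext y q
  by_cases hq : ∃ k, pairEmbedding c t h k = q
  · obtain ⟨k, rfl⟩ := hq
    rw [(pairEmbedding c t h).injective.extend_apply]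
    fin_cases k
    · exact (Function.update_of_ne h _ _).symm
    · exact (Function.update_self t (y t + y c) y).symm
  · rw [Function.extend_apply' _ _ _ hq, Function.update_of_ne]
    rintro rfl
    exact hq ⟨1, rfl⟩

lemma controlledPhase_eval (U : Op K) (θ : ℝ) {c t : Q} (h : c ≠ t) :
    Circuit.eval U (controlledPhase θ c t : Circuit K Q) =
      monomialOp id
        fun y => Complex.exp ((if y c = 1 ∧ y t = 1 then θ else 0 : ℝ) * Complex.I) := by
  rw [controlledPhase, dif_pos h, Circuit.eval_singleton]
  simp only [Step.eval]
  rw [applyOn_monomialOp]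
  congr 1
  funext y
  exact extend_self _ y

end

/-! ### The Toffoli gate -/

section

variable {K Q : Type} [Fintype K] [Fintype Q] [DecidableEq Q]

lemma sqrt_two_inv_mul_self : ((√2 : ℝ) : ℂ)⁻¹ * ((√2 : ℝ) : ℂ)⁻¹ = 1 / 2 := by
  rw [← mul_inv, ← Complex.ofReal_mul, Real.mul_self_sqrt zero_le_two]
  norm_num

/-- The Hadamard matrix. -/
noncomputable def hadamard : Matrix.unitaryGroup (Fin 2) ℂ :=
  ⟨Matrix.of fun u v => ((√2 : ℝ) : ℂ)⁻¹ * (if u = 1 ∧ v = 1 then -1 else 1), by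
    have h := sqrt_two_inv_mul_self
    rw [Matrix.mem_unitaryGroup_iff]
    ext u v
    rw [Matrix.mul_apply, Fin.sum_univ_two]
    fin_cases u <;> fin_cases v <;> simp [h] <;> norm_num⟩

lemma hadamard_apply (u v : Fin 2) : (hadamard : Matrix (Fin 2) (Fin 2) ℂ) u v =
    ((√2 : ℝ) : ℂ)⁻¹ * (if u = 1 ∧ v = 1 then -1 else 1) := rfl

lemma Circuit.eval_append_of_monomialOp {U : Op K} {c₁ c₂ : Circuit K Q}
    {f g : Basis Q → Basis Q} {d d' : Basis Q → ℂ} (h₁ : Circuit.eval U c₁ = monomialOp f d)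
    (h₂ : Circuit.eval U c₂ = monomialOp g d') :
    Circuit.eval U (c₁ ++ c₂) = monomialOp (g ∘ f) fun y => d' (f y) * d y := by
  rw [Circuit.eval_append, h₁, h₂, monomialOp_mul]

/-- The doubly controlled `Z` gate: for bits, `u + v - (u ⊕ v) = 2 u v`, so that the exponents of
`i` in the three controlled phases add up to `2 u v t`. -/
noncomputable def ccz (u v t : Q) : Circuit K Q :=
  controlledPhase (Real.pi / 2) v t ++ controlledPhase (Real.pi / 2) u t ++ cnot u v ++
    controlledPhase (-(Real.pi / 2)) v t ++ cnot u v

lemma fin_two_add_self (u v : Fin 2) : u + v + v = u := by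
  revert u v; decide

lemma ccz_eval (U : Op K) {u v t : Q} (huv : u ≠ v) (hut : u ≠ t) (hvt : v ≠ t) :
    Circuit.eval U (ccz u v t : Circuit K Q) =
      monomialOp id fun y => if y u = 1 ∧ y v = 1 ∧ y t = 1 then -1 else 1 := by
  rw [ccz, Circuit.eval_append_of_monomialOp (Circuit.eval_append_of_monomialOp
    (Circuit.eval_append_of_monomialOp (Circuit.eval_append_of_monomialOp
      (controlledPhase_eval U _ hvt) (controlledPhase_eval U _ hut)) (cnot_eval U huv))
      (controlledPhase_eval U _ hvt)) (cnot_eval U huv)]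
  congr 1
  · funext y
    simp [Function.update_of_ne huv, fin_two_add_self]
  · funext y
    have e1 (p : Prop) [Decidable p] :
        Complex.exp ((if p then Real.pi / 2 else 0 : ℝ) * Complex.I) =
          if p then Complex.I else 1 := by
      split_ifs
      · push_cast; exact Complex.exp_pi_div_two_mul_I
      · simp
    have e2 (p : Prop) [Decidable p] :
        Complex.exp ((if p then -(Real.pi / 2) else 0 : ℝ) * Complex.I) =
          if p then -Complex.I else 1 := by
      split_ifs
      · push_cast; rw [← neg_div]; exact Complex.exp_neg_pi_div_two_mul_I
      · simp
    simp only [e1, e2, Function.comp_apply, id, Function.update_self,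
      Function.update_of_ne hvt.symm]
    have h2 : ∀ w : Fin 2, w = 0 ∨ w = 1 := by decide
    rcases h2 (y u) with h | h <;> rcases h2 (y v) with h' | h' <;>
      rcases h2 (y t) with h'' | h'' <;> simp [h, h', h'']

/-- The Toffoli gate with controls `u`, `v` and target `t`. -/
noncomputable def toffoli (u v t : Q) : Circuit K Q :=
  [oneQubitGate hadamard t] ++ ccz u v t ++ [oneQubitGate hadamard t]

lemma toffoli_eval (U : Op K) {u v t : Q} (huv : u ≠ v) (hut : u ≠ t) (hvt : v ≠ t) :
    Circuit.eval U (toffoli u v t : Circuit K Q) =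
      monomialOp (fun y => Function.update y t (y t + y u * y v)) fun _ => 1 := by
  rw [toffoli, Circuit.eval_append, Circuit.eval_append, Circuit.eval_singleton,
    ccz_eval U huv hut hvt]
  ext x y
  rw [oneQubitGate_eval_mul_apply]
  have hD (d : Basis Q → ℂ) (M : Op Q) (z : Basis Q) : (monomialOp id d * M) z y = d z * M z y := by
    simp [monomialOp, Matrix.mul_apply]
  simp only [hD, oneQubitGate_eval_apply, Function.update_self, Function.update_of_ne hut,
    Function.update_of_ne hvt, Fin.sum_univ_two]
  have hiff (v : Fin 2) : (∀ p, p ≠ t → Function.update x t v p = y p) ↔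
      ∀ p, p ≠ t → x p = y p :=
    forall₂_congr fun p hp => by rw [Function.update_of_ne hp]
  simp only [hiff, monomialOp, Matrix.of_apply]
  by_cases hoff : ∀ p, p ≠ t → x p = y p
  · have hxy : x = Function.update y t (y t + y u * y v) ↔ x t = y t + y u * y v := by
      constructor
      · intro h; rw [h, Function.update_self]
      · intro h
        funext p
        by_cases hp : p = t
        · rw [hp, h, Function.update_self]
        · rw [Function.update_of_ne hp, hoff p hp]
    simp only [if_pos hoff, hxy, hoff u hut, hoff v hvt, hadamard_apply]
    have h2 : ∀ w : Fin 2, w = 0 ∨ w = 1 := by decide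
    have hs := sqrt_two_inv_mul_self
    set s : ℂ := ((√2 : ℝ) : ℂ)⁻¹
    rcases h2 (y u) with h | h <;> rcases h2 (y v) with h' | h' <;>
      rcases h2 (y t) with h'' | h'' <;> rcases h2 (x t) with h3 | h3 <;>
      simp [h, h', h'', h3, hs] <;> norm_num
  · have hxy : x ≠ Function.update y t (y t + y u * y v) := fun h =>
      hoff fun p hp => by rw [h, Function.update_of_ne hp]
    simp only [if_neg hoff, if_neg hxy, mul_zero, add_zero]

/-! ### Multiply controlled gates with borrowed qubits -/

/-- A ladder of Toffoli gates with controls `c 0, …, c (j - 1)` and targets `a 0, …, a (j - 1)`: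
it adds the product of the controls `c 0, …, c i` to the target `a i`, for every `i < j` and
whatever the state of the targets. -/
noncomputable def ladder (c a : ℕ → Q) : ℕ → Circuit K Q
  | 0 => []
  | 1 => cnot (c 0) (a 0)
  | j + 2 => toffoli (c (j + 1)) (a j) (a (j + 1)) ++ ladder c a (j + 1) ++
      toffoli (c (j + 1)) (a j) (a (j + 1))

/-- The action of a ladder on the basis states. -/
def ladderMap (c a : ℕ → Q) : ℕ → Basis Q → Basis Q
  | 0, y => y
  | j + 1, y =>
    Function.update (ladderMap c a j y) (a j) (y (a j) + ∏ i ∈ Finset.range (j + 1), y (c i))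

omit [Fintype Q] in
lemma ladderMap_apply_of_ne {c a : ℕ → Q} {j : ℕ} {q : Q} (h : ∀ i < j, q ≠ a i) (y : Basis Q) :
    ladderMap c a j y q = y q := by
  induction j with
  | zero => rfl
  | succ j ih =>
    rw [ladderMap, Function.update_of_ne (h j (by omega)), ih fun i hi => h i (by omega)]

omit [Fintype Q] in
lemma ladderMap_update {c a : ℕ → Q} {j : ℕ} {q : Q} (h : ∀ i < j, q ≠ a i)
    (h' : ∀ i < j, q ≠ c i) (y : Basis Q) (v : Fin 2) :
    ladderMap c a j (Function.update y q v) = Function.update (ladderMap c a j y) q v := by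
  induction j with
  | zero => rfl
  | succ j ih =>
    have e : ∏ i ∈ Finset.range (j + 1), Function.update y q v (c i) =
        ∏ i ∈ Finset.range (j + 1), y (c i) := Finset.prod_congr rfl fun i hi => by
      rw [Function.update_of_ne (h' i (Finset.mem_range.1 hi)).symm]
    rw [ladderMap, ladderMap, ih (fun i hi => h i (by omega)) (fun i hi => h' i (by omega)), e,
      Function.update_comm (h j (by omega)), Function.update_of_ne (h j (by omega)).symm]

section

variable {c a : ℕ → Q} {h : ℕ} (ha : ∀ i k, i < h → k < h → a i = a k → i = k)
  (hca : ∀ i k, i < h → k < h → c i ≠ a k)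

include ha hca

lemma ladder_eval (U : Op K) {j : ℕ} (hj : j ≤ h) :
    Circuit.eval U (ladder c a j : Circuit K Q) = monomialOp (ladderMap c a j) fun _ => 1 := by
  induction j with
  | zero => exact monomialOp_id_one.symm
  | succ j ih =>
    cases j with
    | zero =>
      rw [ladder, cnot_eval U (hca 0 0 (by omega) (by omega))]
      congr 1
      funext y
      simp [ladderMap]
    | succ j =>
      have h1 : c (j + 1) ≠ a j := hca _ _ (by omega) (by omega)
      have h2 : c (j + 1) ≠ a (j + 1) := hca _ _ (by omega) (by omega)
      have h3 : a j ≠ a (j + 1) := fun h => by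
        have := ha _ _ (by omega) (by omega) h
        omega
      have hT := toffoli_eval U h1 h2 h3
      rw [ladder, Circuit.eval_append_of_monomialOp
        (Circuit.eval_append_of_monomialOp hT (ih (by omega))) hT]
      congr 1
      · funext y
        simp only [Function.comp_apply]
        have h4 : ∀ i < j + 1, a (j + 1) ≠ a i := fun i hi h => by
          have := ha _ _ (by omega) (by omega) h
          omega
        have h5 : ∀ i < j + 1, a (j + 1) ≠ c i := fun i hi =>
          (hca _ _ (by omega) (by omega)).symm
        have h6 : ∀ i < j + 1, c (j + 1) ≠ a i := fun i hi => hca _ _ (by omega) (by omega)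
        have h7 : ladderMap c a (j + 1) y (a j) =
            y (a j) + ∏ i ∈ Finset.range (j + 1), y (c i) := by
          rw [ladderMap, Function.update_self]
        rw [ladderMap_update h4 h5, Function.update_idem, Function.update_self,
          Function.update_of_ne h2, Function.update_of_ne h3, h7, ladderMap_apply_of_ne h6]
        conv_rhs => rw [ladderMap]
        rw [Finset.prod_range_succ (fun i => y (c i)) (j + 1)]
        congr 1
        have key : ∀ s t u v : Fin 2, s + t * u + t * (u + v) = s + v * t := by decide
        exact key _ _ _ _
      · funext y
        simp

omit [Fintype Q] in
lemma ladderMap_ladderMap {j : ℕ} (hj : j ≤ h) (y : Basis Q) :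
    ladderMap c a j (ladderMap c a j y) = y := by
  induction j with
  | zero => rfl
  | succ j ih =>
    have h1 : ∀ i < j, a j ≠ a i := fun i hi h => by
      have := ha _ _ (by omega) (by omega) h
      omega
    have h2 : ∀ i < j, a j ≠ c i := fun i hi => (hca _ _ (by omega) (by omega)).symm
    have h3 : ∀ i ∈ Finset.range (j + 1), ladderMap c a (j + 1) y (c i) = y (c i) := fun i hi =>
      ladderMap_apply_of_ne (fun k hk => hca _ _
        (by have := Finset.mem_range.1 hi; omega) (by omega)) y
    rw [ladderMap, Finset.prod_congr rfl h3, ladderMap, ladderMap_update h1 h2, ih (by omega),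
      Function.update_idem, Function.update_self, fin_two_add_self, Function.update_eq_self]

/-- Running a ladder and then the ladder that is shorter by one rung restores all targets but the
last one. -/
lemma ladder_append_ladder_eval (U : Op K) {j : ℕ} (hj : j < h) :
    Circuit.eval U (ladder c a (j + 1) ++ ladder c a j : Circuit K Q) =
      monomialOp (fun y => Function.update y (a j)
        (y (a j) + ∏ i ∈ Finset.range (j + 1), y (c i))) fun _ => 1 := by
  rw [Circuit.eval_append_of_monomialOp (ladder_eval ha hca U hj) (ladder_eval ha hca U hj.le)]
  congr 1
  · funext y
    have h1 : ∀ i < j, a j ≠ a i := fun i hi h => by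
      have := ha _ _ (by omega) (by omega) h
      omega
    have h2 : ∀ i < j, a j ≠ c i := fun i hi => (hca _ _ (by omega) (by omega)).symm
    rw [Function.comp_apply, ladderMap, ladderMap_update h1 h2,
      ladderMap_ladderMap ha hca hj.le]
  · funext y
    simp

end

/-- The controlled not with target `b` and controls `r 0, …, r (m / 2)`, the first half of the
`m + 1` qubits `r 0, …, r m`. The other half is borrowed, in any state, for the ladder. -/
noncomputable def halfControlledNot (r : ℕ → Q) (b : Q) (m : ℕ) : Circuit K Q :=
  ladder r (fun i => if i = m / 2 then b else r (m / 2 + 1 + i)) (m / 2 + 1) ++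
    ladder r (fun i => if i = m / 2 then b else r (m / 2 + 1 + i)) (m / 2)

lemma halfControlledNot_eval (U : Op K) {r : ℕ → Q} {b : Q} {m : ℕ}
    (hr : ∀ i k, i ≤ m → k ≤ m → r i = r k → i = k) (hb : ∀ i ≤ m, r i ≠ b) :
    Circuit.eval U (halfControlledNot r b m : Circuit K Q) =
      monomialOp (fun y => Function.update y b
        (y b + ∏ i ∈ Finset.range (m / 2 + 1), y (r i))) fun _ => 1 := by
  have h := ladder_append_ladder_eval (K := K) (h := m / 2 + 1) (c := r)
    (a := fun i => if i = m / 2 then b else r (m / 2 + 1 + i))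
    (fun i k hi hk hik => by
      split_ifs at hik with h1 h2 h2
      · omega
      · exact absurd hik.symm (hb _ (by omega))
      · exact absurd hik (hb _ (by omega))
      · have := hr _ _ (by omega) (by omega) hik
        omega)
    (fun i k hi hk hik => by
      split_ifs at hik with h1
      · exact hb _ (by omega) hik
      · have := hr _ _ (by omega) (by omega) hik
        omega) U (j := m / 2) (by omega)
  simpa [halfControlledNot] using h

/-- The group commutator of `c₁` and of the conjugate of `c₂` by a `Z` rotation of `b`. If `c₁` and
`c₂` flip `b` under the conditions `s₁ = 1` and `s₂ = 1`, this is a `Z` rotation of `b` controlled by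
`s₁ = s₂ = 1`. -/
noncomputable def commutatorPhase (c₁ c₂ : Circuit K Q) (b : Q) (θ : ℝ) : Circuit K Q :=
  (c₁ ++ [oneQubitGate (zRotation θ) b]) ++ (c₂ ++ [oneQubitGate (zRotation (-θ)) b]) ++
    ((c₁ ++ [oneQubitGate (zRotation θ) b]) ++ (c₂ ++ [oneQubitGate (zRotation (-θ)) b]))

lemma commutatorPhase_eval {U : Op K} {c₁ c₂ : Circuit K Q} {b : Q} {s₁ s₂ : Basis Q → Fin 2}
    (h₁ : Circuit.eval U c₁ = monomialOp (fun y => Function.update y b (y b + s₁ y)) fun _ => 1)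
    (h₂ : Circuit.eval U c₂ = monomialOp (fun y => Function.update y b (y b + s₂ y)) fun _ => 1)
    (hs₁ : ∀ y v, s₁ (Function.update y b v) = s₁ y)
    (hs₂ : ∀ y v, s₂ (Function.update y b v) = s₂ y) (θ : ℝ) :
    Circuit.eval U (commutatorPhase c₁ c₂ b θ) = monomialOp id fun y =>
      Complex.exp ((if s₁ y = 1 ∧ s₂ y = 1 then -4 * θ * bitSign (y b) else 0 : ℝ) *
        Complex.I) := by
  have hz (θ : ℝ) : Circuit.eval U [(oneQubitGate (zRotation θ) b : Step K Q)] = _ :=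
    (Circuit.eval_singleton U _).trans (zRotation_eval U θ b)
  have h := Circuit.eval_append_of_monomialOp
    (Circuit.eval_append_of_monomialOp h₁ (hz θ)) (Circuit.eval_append_of_monomialOp h₂ (hz (-θ)))
  rw [commutatorPhase, Circuit.eval_append_of_monomialOp h h]
  have h2 : ∀ w : Fin 2, w = 0 ∨ w = 1 := by decide
  congr 1
  · funext y
    simp only [Function.comp_apply, id, hs₁, hs₂, Function.update_idem, Function.update_self]
    have key : ∀ u v w : Fin 2, u + v + w + v + w = u := by decide
    rw [key, Function.update_eq_self]
  · funext y
    simp only [Function.comp_apply, id, hs₁, hs₂, Function.update_idem, Function.update_self,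
      mul_one, ← Complex.exp_add, ← add_mul, ← Complex.ofReal_add]
    congr 3
    rcases h2 (s₁ y) with h | h <;> rcases h2 (s₂ y) with h' | h' <;>
      rcases h2 (y b) with h'' | h'' <;> simp [h, h', h'', bitSign] <;> ring

/-- Pauli `X` gates on the qubits `r 0, …, r (k - 1)`. -/
def flipAll (r : ℕ → Q) : ℕ → Circuit K Q
  | 0 => []
  | k + 1 => flipAll r k ++ [oneQubitGate pauliX (r k)]

lemma flipAll_eval (U : Op K) (r : ℕ → Q) (k : ℕ) (hr : ∀ i j, i < k → j < k → r i = r j → i = j) :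
    Circuit.eval U (flipAll r k : Circuit K Q) =
      monomialOp (fun y q => if ∃ i < k, r i = q then y q + 1 else y q) fun _ => 1 := by
  induction k with
  | zero =>
    simp only [flipAll, not_lt_zero, false_and, exists_false, if_false]
    exact monomialOp_id_one.symm
  | succ k ih =>
    rw [flipAll, Circuit.eval_append_of_monomialOp (ih fun i j hi hj => hr i j (by omega) (by omega))
      ((Circuit.eval_singleton U _).trans (pauliX_eval U _))]
    congr 1
    · funext y q
      have hk : ¬ ∃ i < k, r i = r k := by
        rintro ⟨i, hi, h⟩
        have := hr i k (by omega) (by omega) h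
        omega
      by_cases hq : q = r k
      · subst hq
        simp only [Function.comp_apply, Function.update_self, if_neg hk]
        rw [if_pos ⟨k, by omega, rfl⟩]
      · simp only [Function.comp_apply, Function.update_of_ne hq]
        refine if_congr ⟨fun ⟨i, hi, h⟩ => ⟨i, by omega, h⟩, fun ⟨i, hi, h⟩ => ⟨i, ?_, h⟩⟩ rfl rfl
        rcases Nat.lt_succ_iff_lt_or_eq.1 hi with h' | h'
        · exact h'
        · exact absurd (h' ▸ h).symm hq
    · simp

lemma prod_fin_two_eq_one_iff (s : Finset ℕ) (f : ℕ → Fin 2) :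
    ∏ i ∈ s, f i = 1 ↔ ∀ i ∈ s, f i = 1 := by
  classical
  induction s using Finset.induction_on with
  | empty => simp
  | insert i s hi ih =>
    rw [Finset.prod_insert hi, Finset.forall_mem_insert, ← ih]
    generalize ∏ i ∈ s, f i = u
    generalize f i = v
    revert u v
    decide

/-- The phase `exp (i φ Z ⊗ (2 Π - 1))`, where `Z` acts on the qubit `b` and `Π` is the projector
onto the zero state of the qubits `r 0, …, r m`. The two halves of these qubits are overlapping or
adjacent, and together they cover all of them. -/
noncomputable def projectorPhase (r : ℕ → Q) (b : Q) (m : ℕ) (φ : ℝ) : Circuit K Q :=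
  flipAll r (m + 1) ++
    commutatorPhase (halfControlledNot r b m) (halfControlledNot (fun i => r (m - i)) b m) b
      (-(φ / 2)) ++ flipAll r (m + 1) ++ [oneQubitGate (zRotation (-φ)) b]

lemma projectorPhase_eval (U : Op K) {r : ℕ → Q} {b : Q} {m : ℕ}
    (hr : ∀ i k, i ≤ m → k ≤ m → r i = r k → i = k) (hb : ∀ i ≤ m, r i ≠ b) (φ : ℝ) :
    Circuit.eval U (projectorPhase r b m φ : Circuit K Q) = monomialOp id fun y =>
      Complex.exp (((if ∀ i ≤ m, y (r i) = 0 then φ else -φ) * bitSign (y b) : ℝ) *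
        Complex.I) := by
  have hflip := flipAll_eval (K := K) U r (m + 1) fun i k hi hk => hr i k (by omega) (by omega)
  have hprod (y : Basis Q) (f : ℕ → ℕ) (hf : ∀ i ≤ m, f i ≤ m) (v : Fin 2) :
      ∏ i ∈ Finset.range (m / 2 + 1), Function.update y b v (r (f i)) =
        ∏ i ∈ Finset.range (m / 2 + 1), y (r (f i)) :=
    Finset.prod_congr rfl fun i hi => by
      rw [Function.update_of_ne (hb _ (hf i (by have := Finset.mem_range.1 hi; omega)))]
  have hcomm := commutatorPhase_eval
    (halfControlledNot_eval U hr hb)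
    (halfControlledNot_eval U (r := fun i => r (m - i))
      (fun i k hi hk h => by
        have := hr _ _ (by omega) (by omega) h
        omega) (fun i _ => hb _ (by omega)))
    (fun y v => hprod y id (fun i hi => hi) v)
    (fun y v => hprod y (fun i => m - i) (fun i _ => by omega) v) (-(φ / 2))
  rw [projectorPhase, Circuit.eval_append_of_monomialOp (Circuit.eval_append_of_monomialOp
    (Circuit.eval_append_of_monomialOp hflip hcomm) hflip)
    ((Circuit.eval_singleton U _).trans (zRotation_eval U _ b))]
  congr 1
  · funext y q
    simp only [Function.comp_apply, id]
    split_ifs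
    · exact fin_two_add_self _ _
    · rfl
  · funext y
    have hbn : ¬ ∃ i < m + 1, r i = b := fun ⟨i, hi, h⟩ => hb i (by omega) h
    have hfl (i : ℕ) (hi : i ≤ m) : ∃ k < m + 1, r k = r i := ⟨i, by omega, rfl⟩
    simp only [Function.comp_apply, id, if_neg hbn, mul_one, one_mul, ← Complex.exp_add,
      ← add_mul, ← Complex.ofReal_add, prod_fin_two_eq_one_iff, Finset.mem_range]
    congr 3
    have hbit : ∀ v : Fin 2, v + 1 = 1 ↔ v = 0 := by decide
    have hiff : ((∀ i < m / 2 + 1,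
          (if ∃ k < m + 1, r k = r i then y (r i) + 1 else y (r i)) = 1) ∧
        ∀ i < m / 2 + 1,
          (if ∃ k < m + 1, r k = r (m - i) then y (r (m - i)) + 1 else y (r (m - i))) = 1) ↔
        ∀ i ≤ m, y (r i) = 0 := by
      constructor
      · rintro ⟨h1, h2⟩ i hi
        by_cases him : i < m / 2 + 1
        · have := h1 i him
          rwa [if_pos (hfl i hi), hbit] at this
        · have := h2 (m - i) (by omega)
          rwa [show m - (m - i) = i by omega, if_pos (hfl i hi), hbit] at this
      · intro h
        refine ⟨fun i hi => ?_, fun i hi => ?_⟩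
        · rw [if_pos (hfl i (by omega)), hbit]
          exact h i (by omega)
        · rw [if_pos (hfl (m - i) (by omega)), hbit]
          exact h (m - i) (by omega)
    rw [if_congr hiff rfl rfl]
    split_ifs <;> simp
    ring

/-! ### Gate counts -/

omit [Fintype K] [Fintype Q] in
lemma cnot_gates_le (c t : Q) : Circuit.gates (cnot c t : Circuit K Q) ≤ 1 := by
  unfold cnot
  split_ifs <;> simp [Circuit.gates, Step.gates]

omit [Fintype K] [Fintype Q] in
lemma controlledPhase_gates_le (θ : ℝ) (c t : Q) :
    Circuit.gates (controlledPhase θ c t : Circuit K Q) ≤ 1 := by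
  unfold controlledPhase
  split_ifs <;> simp [Circuit.gates, Step.gates]

omit [Fintype K] [Fintype Q] [DecidableEq Q] in
lemma oneQubitGate_gates (V : Matrix.unitaryGroup (Fin 2) ℂ) (q : Q) :
    Circuit.gates [(oneQubitGate V q : Step K Q)] = 1 := rfl

omit [Fintype K] [Fintype Q] in
lemma toffoli_gates_le (u v t : Q) : Circuit.gates (toffoli u v t : Circuit K Q) ≤ 7 := by
  simp only [toffoli, ccz, Circuit.gates_append, oneQubitGate_gates]
  have h1 := controlledPhase_gates_le (K := K) (Real.pi / 2) v t
  have h2 := controlledPhase_gates_le (K := K) (Real.pi / 2) u t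
  have h3 := controlledPhase_gates_le (K := K) (-(Real.pi / 2)) v t
  have h4 := cnot_gates_le (K := K) u v
  omega

omit [Fintype K] [Fintype Q] in
lemma ladder_gates_le (c a : ℕ → Q) (j : ℕ) :
    Circuit.gates (ladder c a j : Circuit K Q) ≤ 14 * j := by
  induction j with
  | zero => simp [ladder, Circuit.gates]
  | succ j ih =>
    cases j with
    | zero => exact (cnot_gates_le _ _).trans (by norm_num)
    | succ j =>
      rw [ladder, Circuit.gates_append, Circuit.gates_append]
      have := toffoli_gates_le (K := K) (c (j + 1)) (a j) (a (j + 1))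
      omega

omit [Fintype K] [Fintype Q] in
lemma halfControlledNot_gates_le (r : ℕ → Q) (b : Q) (m : ℕ) :
    Circuit.gates (halfControlledNot r b m : Circuit K Q) ≤ 14 * (m + 1) := by
  rw [halfControlledNot, Circuit.gates_append]
  have h1 := ladder_gates_le (K := K) r
    (fun i => if i = m / 2 then b else r (m / 2 + 1 + i)) (m / 2 + 1)
  have h2 := ladder_gates_le (K := K) r
    (fun i => if i = m / 2 then b else r (m / 2 + 1 + i)) (m / 2)
  omega

omit [Fintype K] [Fintype Q] [DecidableEq Q] in
lemma flipAll_gates (r : ℕ → Q) (k : ℕ) : Circuit.gates (flipAll r k : Circuit K Q) = k := by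
  induction k with
  | zero => rfl
  | succ k ih => rw [flipAll, Circuit.gates_append, ih, oneQubitGate_gates]

omit [Fintype K] [Fintype Q] in
lemma projectorPhase_gates_le (r : ℕ → Q) (b : Q) (m : ℕ) (φ : ℝ) :
    Circuit.gates (projectorPhase r b m φ : Circuit K Q) ≤ 63 * (m + 1) := by
  simp only [projectorPhase, commutatorPhase, Circuit.gates_append, flipAll_gates,
    oneQubitGate_gates]
  have h1 := halfControlledNot_gates_le (K := K) r b m
  have h2 := halfControlledNot_gates_le (K := K) (fun i => r (m - i)) b m
  omega

omit [Fintype K] [Fintype Q] [DecidableEq Q] in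
lemma oneQubitGate_queries (V : Matrix.unitaryGroup (Fin 2) ℂ) (q : Q) :
    Circuit.queries [(oneQubitGate V q : Step K Q)] = 0 := rfl

omit [Fintype K] [Fintype Q] in
lemma toffoli_queries (u v t : Q) : Circuit.queries (toffoli u v t : Circuit K Q) = 0 := by
  simp only [toffoli, ccz, Circuit.queries_append, oneQubitGate_queries, cnot, controlledPhase]
  split_ifs <;> simp [Circuit.queries, Step.queries]

omit [Fintype K] [Fintype Q] in
lemma ladder_queries (c a : ℕ → Q) (j : ℕ) :
    Circuit.queries (ladder c a j : Circuit K Q) = 0 := by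
  induction j with
  | zero => rfl
  | succ j ih =>
    cases j with
    | zero =>
      rw [ladder, cnot]
      split_ifs <;> simp [Circuit.queries, Step.queries]
    | succ j => rw [ladder, Circuit.queries_append, Circuit.queries_append, toffoli_queries, ih]

omit [Fintype K] [Fintype Q] [DecidableEq Q] in
lemma flipAll_queries (r : ℕ → Q) (k : ℕ) : Circuit.queries (flipAll r k : Circuit K Q) = 0 := by
  induction k with
  | zero => rfl
  | succ k ih => rw [flipAll, Circuit.queries_append, ih, oneQubitGate_queries]

omit [Fintype K] [Fintype Q] in
lemma projectorPhase_queries (r : ℕ → Q) (b : Q) (m : ℕ) (φ : ℝ) :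
    Circuit.queries (projectorPhase r b m φ : Circuit K Q) = 0 := by
  simp only [projectorPhase, commutatorPhase, halfControlledNot, Circuit.queries_append,
    flipAll_queries, oneQubitGate_queries, ladder_queries]

end

/-! ### Singular value transformation of an abstract block-encoding -/

section

variable {B I : Type} [Fintype B] [DecidableEq B] [Fintype I] [DecidableEq I]

open Polynomial in
/-- The operator `J p(A) + (W J - J A) q(A)`. Its second term maps into the orthogonal complement of
the range of the isometry `J` if `W` block-encodes `A` with respect to `J`. -/
noncomputable def qsvtState (J : Matrix B I ℂ) (A : Matrix I I ℂ) (W : Matrix B B ℂ)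
    (pq : ℂ[X] × ℂ[X]) : Matrix B I ℂ :=
  J * aeval A pq.1 + (W * J - J * A) * aeval A pq.2

open Polynomial in
lemma mul_qsvtState {J : Matrix B I ℂ} {A : Matrix I I ℂ} {V W : Matrix B B ℂ} (h : V * W = 1)
    (p q : ℂ[X]) : V * qsvtState J A W (p, q) =
      qsvtState J A V (X * p + (1 - X ^ 2) * q, p - X * q) := by
  have h' (M : Matrix B I ℂ) : V * (W * M) = M := by
    rw [← Matrix.mul_assoc, h, Matrix.one_mul]
  simp only [qsvtState, map_add, map_sub, map_mul, map_one, aeval_X, pow_two,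
    Matrix.mul_add, Matrix.mul_sub, Matrix.sub_mul, Matrix.mul_assoc, h', Matrix.one_mul]
  abel

omit [DecidableEq B] in
open Polynomial in
lemma phase_mul_qsvtState {J : Matrix B I ℂ} {A : Matrix I I ℂ} {W P : Matrix B B ℂ} {u v : ℂ}
    (hu : P * J = u • J) (hv : P * (W * J - J * A) = v • (W * J - J * A)) (p q : ℂ[X]) :
    P * qsvtState J A W (p, q) = qsvtState J A W (C u * p, C v * q) := by
  simp only [qsvtState, map_mul, aeval_C, Algebra.algebraMap_eq_smul_one, Matrix.mul_add,
    ← Matrix.mul_assoc, hu, hv]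
  simp only [Matrix.smul_mul, Matrix.mul_smul, Matrix.mul_one]

end

/-- Alternating sequence of a circuit, its inverse, and phases, in `d + 1` phases and `d` calls. -/
def qsvtCircuit {K Q : Type} (V : Bool → Circuit K Q) (P : ℝ → Circuit K Q) (φ : ℕ → ℝ) :
    ℕ → Circuit K Q
  | 0 => P (φ 0)
  | d + 1 => qsvtCircuit V P φ d ++ V d.bodd ++ P (φ (d + 1))

lemma qsvtCircuit_eval_mul {K Q I : Type} [Fintype K] [Fintype Q] [DecidableEq Q] [Fintype I]
    [DecidableEq I] {U : Op K} {V : Bool → Circuit K Q} {P : ℝ → Circuit K Q}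
    {J : Matrix (Basis Q) I ℂ} {A : Matrix I I ℂ} {s : ℝ}
    (hV : ∀ adj, Circuit.eval U (V adj) * Circuit.eval U (V !adj) = 1)
    (hJ : ∀ φ, Circuit.eval U (P φ) * J = Complex.exp ((s * φ : ℝ) * Complex.I) • J)
    (hJ' : ∀ φ adj, Circuit.eval U (P φ) * (Circuit.eval U (V adj) * J - J * A) =
      Complex.exp (-((s * φ : ℝ) * Complex.I)) • (Circuit.eval U (V adj) * J - J * A))
    (φ : ℕ → ℝ) (d : ℕ) :
    Circuit.eval U (qsvtCircuit V P φ d) * J =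
      qsvtState J A (Circuit.eval U (V !d.bodd)) (qspPair (fun i => s * φ i) d) := by
  induction d with
  | zero =>
    rw [qsvtCircuit, hJ, qspPair, qsvtState, Polynomial.aeval_C, map_zero, Matrix.mul_zero,
      add_zero, Algebra.algebraMap_eq_smul_one, Matrix.mul_smul, Matrix.mul_one]
  | succ d ih =>
    rw [qsvtCircuit, Circuit.eval_append, Circuit.eval_append, Matrix.mul_assoc, Matrix.mul_assoc,
      ih, Nat.bodd_succ, Bool.not_not, mul_qsvtState (hV _), phase_mul_qsvtState (hJ _) (hJ' _ _)]
    rfl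

/-! ### The ancilla qubits and the shifted block-encoding -/

section

variable {m n : ℕ}

/-- The ancilla qubit with number `i ≤ m + 1`. -/
def anc (m n i : ℕ) : Reg (m + 2) n := Sum.inl (Fin.ofNat (m + 2) i)

lemma anc_injective {i k : ℕ} (hi : i ≤ m + 1) (hk : k ≤ m + 1) (h : anc m n i = anc m n k) :
    i = k := by
  have h1 := congrArg Fin.val (Sum.inl_injective h)
  simp only [Fin.ofNat] at h1
  rwa [Nat.mod_eq_of_lt (by omega), Nat.mod_eq_of_lt (by omega)] at h1

lemma anc_ne {i k : ℕ} (hi : i ≤ m + 1) (hk : k ≤ m + 1) (h : i ≠ k) :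
    anc m n i ≠ anc m n k := fun h' => h (anc_injective hi hk h')

/-- The oracle acts on the first `m` ancilla qubits and on the system. -/
def oracleEmbedding (m n : ℕ) : Reg m n ↪ Reg (m + 2) n :=
  Function.Embedding.sumMap (Fin.castAddEmb 2) (Function.Embedding.refl _)

lemma oracleEmbedding_ne_anc {i : ℕ} (hi : m ≤ i) (hi' : i ≤ m + 1) (k : Reg m n) :
    oracleEmbedding m n k ≠ anc m n i := by
  rcases k with k | k
  · intro h
    have h1 := congrArg Fin.val (Sum.inl_injective h)
    simp only [Fin.ofNat, Nat.mod_eq_of_lt (show i < m + 2 by omega)] at h1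
    have h2 : (Fin.castAddEmb 2 k).val = k.val := rfl
    have := k.2
    change (Fin.castAddEmb 2 k).val = i at h1
    omega
  · exact fun h => by cases h

/-- Every ancilla qubit outside the range of the oracle is one of the last two. -/
lemma eq_anc_of_forall_ne {q : Reg (m + 2) n} (hq : ∀ k, oracleEmbedding m n k ≠ q) :
    q = anc m n m ∨ q = anc m n (m + 1) := by
  rcases q with q | q
  · have h : m ≤ q.val := by
      by_contra h
      exact hq (Sum.inl ⟨q.val, by omega⟩) rfl
    have := q.2
    rcases (show q.val = m ∨ q.val = m + 1 by omega) with h' | h'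
    · refine Or.inl (congrArg Sum.inl (Fin.ext ?_))
      simp only [Fin.ofNat, Nat.mod_eq_of_lt (show m < m + 2 by omega), h']
    · refine Or.inr (congrArg Sum.inl (Fin.ext ?_))
      simp only [Fin.ofNat, Nat.mod_eq_of_lt (show m + 1 < m + 2 by omega), h']
  · exact absurd rfl (hq (Sum.inr q))

/-- The basis state with system state `j`, last ancilla qubit `v` and all other ancilla qubits
zero. -/
def startState (m : ℕ) {n : ℕ} (v : Fin 2) (j : Basis (Fin n)) : Basis (Reg (m + 2) n) :=
  Function.update (Sum.elim 0 j) (anc m n (m + 1)) v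

lemma startState_last (v : Fin 2) (j : Basis (Fin n)) : startState m v j (anc m n (m + 1)) = v :=
  Function.update_self _ _ _

lemma startState_inr (v : Fin 2) (j : Basis (Fin n)) (k : Fin n) :
    startState m v j (Sum.inr k) = j k := by
  rw [startState, Function.update_of_ne (by simp [anc])]
  rfl

lemma startState_anc (v : Fin 2) (j : Basis (Fin n)) {i : ℕ} (hi : i ≤ m) :
    startState m v j (anc m n i) = 0 := by
  rw [startState, Function.update_of_ne (anc_ne (by omega) le_rfl (by omega))]
  rfl

lemma startState_injective (v : Fin 2) :
    Function.Injective (startState m v : Basis (Fin n) → _) := fun i j h => by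
  funext k
  rw [← startState_inr (m := m) v i, ← startState_inr (m := m) v j, h]

lemma startState_comp_oracleEmbedding (v w : Fin 2) (j : Basis (Fin n)) :
    (fun k => Function.update (startState m v j) (anc m n m) w (oracleEmbedding m n k)) =
      (Sum.elim 0 j : Basis (Reg m n)) := by
  funext k
  rw [Function.update_of_ne (oracleEmbedding_ne_anc le_rfl (by omega) k), startState,
    Function.update_of_ne (oracleEmbedding_ne_anc (by omega) le_rfl k)]
  rcases k with k | k <;> rfl

lemma eq_startState {x : Basis (Reg (m + 2) n)} (hx : ∀ i ≤ m, x (anc m n i) = 0) :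
    x = startState m (x (anc m n (m + 1))) fun k => x (Sum.inr k) := by
  funext q
  rcases q with q | q
  · have hq : (Sum.inl q : Reg (m + 2) n) = anc m n q.val := by
      refine congrArg Sum.inl (Fin.ext ?_)
      simp only [Fin.ofNat, Nat.mod_eq_of_lt q.2]
    rw [hq]
    by_cases h : q.val ≤ m
    · rw [hx _ h, startState_anc _ _ h]
    · have : q.val = m + 1 := by have := q.2; omega
      rw [this, startState_last]
  · rw [startState_inr]

/-- The linear combination of the oracle and the identity whose coefficients are given by the
first row of `L` and the first column of `R`, or its inverse: the oracle is controlled by an ancilla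
qubit on which `R` acts before and `L` after the query. -/
def shiftCircuit (m n : ℕ) (L R : Matrix.unitaryGroup (Fin 2) ℂ) (adj : Bool) :
    Circuit (Reg m n) (Reg (m + 2) n) :=
  [oneQubitGate (if adj then star L else R) (anc m n m),
    .controlledQuery adj (oracleEmbedding m n) (anc m n m)
      (oracleEmbedding_ne_anc le_rfl (by omega)),
    oneQubitGate (if adj then star R else L) (anc m n m)]

variable {U : Op (Reg m n)} {L R : Matrix.unitaryGroup (Fin 2) ℂ}

lemma shiftCircuit_eval (adj : Bool) :
    Circuit.eval U (shiftCircuit m n L R adj) =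
      (oneQubitGate (if adj then star R else L) (anc m n m) : Step (Reg m n) _).eval U *
        (controlled (anc m n m) (applyOn (oracleEmbedding m n) (oracleOp U adj)) *
          (oneQubitGate (if adj then star L else R) (anc m n m) : Step (Reg m n) _).eval U) := by
  simp only [shiftCircuit, Circuit.eval, Matrix.one_mul, Matrix.mul_assoc]
  rfl

lemma shiftCircuit_eval_true :
    Circuit.eval U (shiftCircuit m n L R true) =
      (Circuit.eval U (shiftCircuit m n L R false)).conjTranspose := by
  have hp := preserves_applyOn (oracleEmbedding m n) U (oracleEmbedding_ne_anc le_rfl (by omega))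
  simp only [shiftCircuit_eval, if_true, Matrix.conjTranspose_mul, Bool.false_eq_true,
    oneQubitGate_eval_conjTranspose, oracleOp, if_false]
  rw [controlled_conjTranspose hp, applyOn_conjTranspose, Matrix.mul_assoc]

lemma shiftCircuit_eval_preserves (adj : Bool) :
    Preserves (anc m n (m + 1)) (Circuit.eval U (shiftCircuit m n L R adj)) := by
  have hne : anc m n m ≠ anc m n (m + 1) := anc_ne (by omega) le_rfl (by omega)
  rw [shiftCircuit_eval]
  exact (oneQubitGate_eval_preserves U _ hne).mul ((Preserves.controlled (preserves_applyOn _ _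
    (oracleEmbedding_ne_anc (by omega) le_rfl)) _).mul (oneQubitGate_eval_preserves U _ hne))

lemma mul_oneQubitGate_eval_apply {K Q : Type} [Fintype K] [Fintype Q] [DecidableEq Q] (U : Op K)
    (V : Matrix.unitaryGroup (Fin 2) ℂ) (q : Q) (M : Op Q) (x y : Basis Q) :
    (M * (oneQubitGate V q : Step K Q).eval U) x y =
      ∑ v, M x (Function.update y q v) * (V : Matrix (Fin 2) (Fin 2) ℂ) v (y q) := by
  have h : M * (oneQubitGate V q : Step K Q).eval U =
      ((oneQubitGate (star V) q : Step K Q).eval U * M.conjTranspose).conjTranspose := by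
    rw [Matrix.conjTranspose_mul, oneQubitGate_eval_conjTranspose, star_star,
      Matrix.conjTranspose_conjTranspose]
  rw [h, Matrix.conjTranspose_apply, oneQubitGate_eval_mul_apply, star_sum]
  refine Finset.sum_congr rfl fun v _ => ?_
  simp [Matrix.star_apply, mul_comm]

/-- The block of the shifted encoding is `L₀₁ R₁₀ (⟨0| U |0⟩) + L₀₀ R₀₀ I`. -/
lemma shiftCircuit_eval_apply (v : Fin 2) (i j : Basis (Fin n)) :
    Circuit.eval U (shiftCircuit m n L R false) (startState m v i) (startState m v j) =
      ((L : Matrix (Fin 2) (Fin 2) ℂ) 0 1 * (R : Matrix (Fin 2) (Fin 2) ℂ) 1 0) * zeroBlock U i j +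
        ((L : Matrix (Fin 2) (Fin 2) ℂ) 0 0 * (R : Matrix (Fin 2) (Fin 2) ℂ) 0 0) *
          (1 : Op (Fin n)) i j := by
  have ha (w : Fin 2) (x : Basis (Reg (m + 2) n)) :
      Function.update x (anc m n m) w (anc m n m) = w := Function.update_self _ _ _
  have hne (x y : Basis (Reg (m + 2) n)) :
      Function.update x (anc m n m) 0 ≠ Function.update y (anc m n m) 1 := fun h => by
    have := congrFun h (anc m n m)
    rw [ha, ha] at this
    exact zero_ne_one this
  have hfix (w : Fin 2) : Function.update (startState m w i) (anc m n m) 0 = startState m w i := by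
    rw [← startState_anc w i (le_refl m), Function.update_eq_self]
  have hfix' (w : Fin 2) :
      Function.update (startState m w j) (anc m n m) 0 = startState m w j := by
    rw [← startState_anc w j (le_refl m), Function.update_eq_self]
  have h10 : applyOn (oracleEmbedding m n) U (Function.update (startState m v i) (anc m n m) 1)
      (startState m v j) = 0 := by
    by_contra h
    have := preserves_applyOn (oracleEmbedding m n) U
      (oracleEmbedding_ne_anc le_rfl (by omega)) _ _ h
    rw [ha, startState_anc _ _ le_rfl] at this
    exact one_ne_zero this
  have h11 : applyOn (oracleEmbedding m n) U (Function.update (startState m v i) (anc m n m) 1)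
      (Function.update (startState m v j) (anc m n m) 1) = zeroBlock U i j := by
    rw [applyOn, Matrix.of_apply, if_pos, startState_comp_oracleEmbedding,
      startState_comp_oracleEmbedding]
    · rfl
    · intro q hq
      rcases eq_anc_of_forall_ne hq with rfl | rfl
      · rw [ha, ha]
      · have hq' : anc m n (m + 1) ≠ anc m n m := anc_ne le_rfl (by omega) (by omega)
        rw [Function.update_of_ne hq', Function.update_of_ne hq', startState_last, startState_last]
  have hone : (1 : Op (Fin n)) i j = if startState m v i = startState m v j then 1 else 0 := by
    simp only [Matrix.one_apply, (startState_injective v).eq_iff]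
  have hne1 : startState m v i ≠ Function.update (startState m v j) (anc m n m) 1 := by
    rw [← hfix]
    exact hne _ _
  rw [shiftCircuit_eval, oneQubitGate_eval_mul_apply]
  simp only [mul_oneQubitGate_eval_apply, Fin.sum_univ_two, oracleOp, controlled,
    Matrix.of_apply, ha, startState_anc _ _ (le_refl m), hfix, hfix', Bool.false_eq_true, if_false,
    if_true, h10, h11, hone, if_neg hne1, zero_ne_one]
  ring

end

/-! ### The filtering circuit -/

section

variable {m n : ℕ}

/-- Singular value transformation of the shifted encoding; the Hadamard gates on the last ancilla
qubit average over the two signs of the phases. -/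
noncomputable def filterCircuit (m n : ℕ) (L R : Matrix.unitaryGroup (Fin 2) ℂ) (φ : ℕ → ℝ)
    (d : ℕ) : Circuit (Reg m n) (Reg (m + 2) n) :=
  [oneQubitGate hadamard (anc m n (m + 1))] ++
    qsvtCircuit (shiftCircuit m n L R) (projectorPhase (anc m n) (anc m n (m + 1)) m) φ d ++
      [oneQubitGate hadamard (anc m n (m + 1))]

lemma filterCircuit_queries (L R : Matrix.unitaryGroup (Fin 2) ℂ) (φ : ℕ → ℝ) (d : ℕ) :
    Circuit.queries (filterCircuit m n L R φ d) = d := by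
  rw [filterCircuit, Circuit.queries_append, Circuit.queries_append, oneQubitGate_queries, zero_add,
    add_zero]
  induction d with
  | zero => exact projectorPhase_queries _ _ _ _
  | succ d ih =>
    rw [qsvtCircuit, Circuit.queries_append, Circuit.queries_append, ih, projectorPhase_queries]
    rfl

lemma filterCircuit_gates_le (L R : Matrix.unitaryGroup (Fin 2) ℂ) (φ : ℕ → ℝ) (d : ℕ) :
    Circuit.gates (filterCircuit m n L R φ d) ≤ 65 * (m + 1) * (d + 1) := by
  have h (d : ℕ) : Circuit.gates (qsvtCircuit (shiftCircuit m n L R)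
      (projectorPhase (anc m n) (anc m n (m + 1)) m) φ d) ≤ 63 * (m + 1) * (d + 1) + 2 * d := by
    induction d with
    | zero => exact (projectorPhase_gates_le _ _ _ _).trans (by omega)
    | succ d ih =>
      rw [qsvtCircuit, Circuit.gates_append, Circuit.gates_append]
      have h1 := projectorPhase_gates_le (K := Reg m n) (anc m n) (anc m n (m + 1)) m (φ (d + 1))
      have h2 : Circuit.gates (shiftCircuit m n L R d.bodd) = 2 := rfl
      rw [h2]
      linarith
  rw [filterCircuit, Circuit.gates_append, Circuit.gates_append, oneQubitGate_gates]
  have := h d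
  nlinarith [Nat.zero_le (m * d)]

open Polynomial in
/-- If `L` and `R` are such that the shifted encoding has block `A`, the filtering circuit has the
block `S(A)`, with `S` the real part of the polynomial that is generated by the phases. -/
theorem zeroBlock_filterCircuit_eval {U : Op (Reg m n)}
    (hU : U ∈ Matrix.unitaryGroup (Basis (Reg m n)) ℂ) {L R : Matrix.unitaryGroup (Fin 2) ℂ}
    {A : Op (Fin n)} (hA : A.IsHermitian)
    (hLR : ((L : Matrix (Fin 2) (Fin 2) ℂ) 0 1 * (R : Matrix (Fin 2) (Fin 2) ℂ) 1 0) •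
        zeroBlock U + ((L : Matrix (Fin 2) (Fin 2) ℂ) 0 0 * (R : Matrix (Fin 2) (Fin 2) ℂ) 0 0) •
          (1 : Op (Fin n)) = A)
    {φ : ℕ → ℝ} {d : ℕ} {S : ℝ[X]}
    (hφ : (qspPair φ d).1 + (qspPair (-φ) d).1 = 2 * S.map (algebraMap ℝ ℂ)) :
    zeroBlock (Circuit.eval U (filterCircuit m n L R φ d)) = aeval A S := by
  set V : Bool → Op (Reg (m + 2) n) := fun adj => Circuit.eval U (shiftCircuit m n L R adj) with hV
  have hblock (adj : Bool) (v : Fin 2) (i j : Basis (Fin n)) :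
      V adj (startState m v i) (startState m v j) = A i j := by
    have h (i j : Basis (Fin n)) : V false (startState m v i) (startState m v j) = A i j := by
      rw [hV]
      simp only [shiftCircuit_eval_apply]
      rw [← hLR]
      rfl
    cases adj
    · exact h i j
    · rw [hV]
      simp only [shiftCircuit_eval_true]
      rw [Matrix.conjTranspose_apply]
      change star (V false _ _) = _
      rw [h]
      exact congrFun (congrFun hA i) j
  have hVV (adj : Bool) : V adj * V (!adj) = 1 := by
    have hu := Circuit.eval_mem_unitaryGroup hU (shiftCircuit m n L R false)
    cases adj
    · simp only [hV, Bool.not_false, shiftCircuit_eval_true]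
      exact Matrix.mem_unitaryGroup_iff.1 hu
    · simp only [hV, Bool.not_true, shiftCircuit_eval_true]
      exact Matrix.mem_unitaryGroup_iff'.1 hu
  let J (v : Fin 2) : Matrix (Basis (Reg (m + 2) n)) (Basis (Fin n)) ℂ := basisMap (startState m v)
  have hJapp (v : Fin 2) (x) (j) : J v x j = if x = startState m v j then 1 else 0 := rfl
  have hJA (v : Fin 2) (i : Basis (Fin n)) (j) (M : Op (Fin n)) :
      (J v * M) (startState m v i) j = M i j := by
    simp [Matrix.mul_apply, hJapp, (startState_injective v).eq_iff]
  have hJ0 (v : Fin 2) (x) (hx : x (anc m n (m + 1)) ≠ v) (j) (M : Op (Fin n)) :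
      (J v * M) x j = 0 := by
    rw [Matrix.mul_apply]
    refine Finset.sum_eq_zero fun k _ => ?_
    rw [hJapp, if_neg, zero_mul]
    rintro rfl
    exact hx (startState_last _ _)
  have hVJ (adj : Bool) (v : Fin 2) (x) (j) : (V adj * J v) x j = V adj x (startState m v j) := by
    simp only [J, mul_basisMap]
    rfl
  -- The complementary term of the state lives on the basis states with last ancilla qubit `v` for
  -- which the other ancilla qubits are not all zero.
  have hD (adj : Bool) (v : Fin 2) (x) (j)
      (hx : x (anc m n (m + 1)) ≠ v ∨ ∀ i ≤ m, x (anc m n i) = 0) :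
      (V adj * J v - J v * A) x j = 0 := by
    rw [Matrix.sub_apply, hVJ]
    by_cases hxv : x (anc m n (m + 1)) = v
    · have hx' := eq_startState (hx.resolve_left fun h => h hxv)
      rw [hxv] at hx'
      rw [hx', hblock, hJA, sub_self]
    · rw [hJ0 v x hxv, sub_zero]
      by_contra h
      exact hxv ((shiftCircuit_eval_preserves adj _ _ h).trans (startState_last _ _))
  have hphase (φ : ℝ) := projectorPhase_eval (K := Reg m n) U (r := anc m n)
    (b := anc m n (m + 1)) (m := m)
    (fun i k hi hk => anc_injective (by omega) (by omega))
    (fun i hi => anc_ne (by omega) le_rfl (by omega)) φ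
  have hdiag (g : Basis (Reg (m + 2) n) → ℂ)
      (M : Matrix (Basis (Reg (m + 2) n)) (Basis (Fin n)) ℂ) (x j) :
      (monomialOp id g * M) x j = g x * M x j := by
    simp [monomialOp, Matrix.mul_apply]
  have hstate (v : Fin 2) := qsvtCircuit_eval_mul (U := U) (V := shiftCircuit m n L R)
    (P := projectorPhase (anc m n) (anc m n (m + 1)) m) (J := J v) (A := A) (s := bitSign v) hVV
    (fun φ => by
      ext x j
      rw [hphase, hdiag, Matrix.smul_apply, smul_eq_mul, hJapp]
      by_cases hx : x = startState m v j
      · rw [if_pos (fun i hi => by rw [hx, startState_anc _ _ hi]), hx, startState_last,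
          mul_comm φ]
      · rw [if_neg hx, mul_zero, mul_zero])
    (fun φ adj => by
      ext x j
      rw [hphase, hdiag, Matrix.smul_apply, smul_eq_mul]
      change _ * (V adj * J v - J v * A) x j = _ * (V adj * J v - J v * A) x j
      by_cases hx : x (anc m n (m + 1)) ≠ v ∨ ∀ i ≤ m, x (anc m n i) = 0
      · rw [hD adj v x j hx, mul_zero, mul_zero]
      · push Not at hx
        rw [if_neg (by push Not; exact hx.2), hx.1]
        congr 2
        push_cast
        ring) φ d
  set M := Circuit.eval U (qsvtCircuit (shiftCircuit m n L R)
    (projectorPhase (anc m n) (anc m n (m + 1)) m) φ d) with hM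
  have hentry (v w : Fin 2) (i j : Basis (Fin n)) :
      M (startState m v i) (startState m w j) =
        if v = w then aeval A (qspPair (fun k => bitSign w * φ k) d).1 i j else 0 := by
    have h1 : M (startState m v i) (startState m w j) = (M * J w) (startState m v i) j := by
      simp only [J, mul_basisMap]
      rfl
    rw [h1, hstate w, qsvtState, Matrix.add_apply, Matrix.mul_apply (M := _ - _)]
    rw [Finset.sum_eq_zero (s := Finset.univ) (fun k _ => by
      change (V _ * J w - J w * A) _ k * _ = 0
      rw [hD _ _ _ _ (Or.inr fun i hi => startState_anc _ _ hi), zero_mul]), add_zero]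
    split_ifs with h
    · rw [h, hJA]
    · exact hJ0 w _ (by rw [startState_last]; exact h) _ _
  have hsign0 : (fun k => bitSign 0 * φ k) = φ := by
    funext k; simp [bitSign]
  have hsign1 : (fun k => bitSign 1 * φ k) = -φ := by
    funext k; simp [bitSign]
  have hsum : aeval A (qspPair φ d).1 + aeval A (qspPair (-φ) d).1 = (2 : ℂ) • aeval A S := by
    rw [← map_add, hφ, map_mul, aeval_map_algebraMap, map_ofNat, two_smul, two_mul]
  ext i j
  have hs := sqrt_two_inv_mul_self
  have hupd (v : Fin 2) (j : Basis (Fin n)) :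
      Function.update (Sum.elim 0 j : Basis (Reg (m + 2) n)) (anc m n (m + 1)) v =
        startState m v j := rfl
  have h0 (j : Basis (Fin n)) : (Sum.elim 0 j : Basis (Reg (m + 2) n)) (anc m n (m + 1)) = 0 := rfl
  rw [zeroBlock, Matrix.of_apply, filterCircuit, Circuit.eval_append, Circuit.eval_append,
    Circuit.eval_singleton, ← hM, oneQubitGate_eval_mul_apply]
  simp only [mul_oneQubitGate_eval_apply, Fin.sum_univ_two, hupd, h0, hentry, if_true, hsign0,
    hsign1, hadamard_apply, zero_ne_one, one_ne_zero, false_and, and_false, if_false, mul_one]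
  have hij := congrFun (congrFun hsum i) j
  rw [Matrix.add_apply, Matrix.smul_apply, smul_eq_mul] at hij
  linear_combination (aeval A (qspPair φ d).1 i j + aeval A (qspPair (-φ) d).1 i j) * hs +
    (1 / 2) * hij

end

/-! ### Choice of parameters -/

/-- The real orthogonal matrix with columns `(± c, ∓ s)` and `(s, c)`. -/
lemma exists_unitary_of_sq_add_sq {σ c s : ℝ} (hσ : σ ^ 2 = 1) (h : c ^ 2 + s ^ 2 = 1) :
    (Matrix.of ![![((σ * c : ℝ) : ℂ), ((s : ℝ) : ℂ)], ![((-σ * s : ℝ) : ℂ), ((c : ℝ) : ℂ)]] :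
      Matrix (Fin 2) (Fin 2) ℂ) ∈ Matrix.unitaryGroup (Fin 2) ℂ := by
  have hσ' : (σ : ℂ) ^ 2 = 1 := by exact_mod_cast hσ
  have h' : (c : ℂ) ^ 2 + (s : ℂ) ^ 2 = 1 := by exact_mod_cast h
  rw [Matrix.mem_unitaryGroup_iff]
  ext i j
  rw [Matrix.mul_apply, Fin.sum_univ_two]
  fin_cases i <;> fin_cases j <;> simp [Matrix.star_apply]
  · linear_combination (c : ℂ) ^ 2 * hσ' + h'
  · linear_combination -(c : ℂ) * s * hσ'
  · linear_combination -(c : ℂ) * s * hσ'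
  · linear_combination (s : ℂ) ^ 2 * hσ' + h'

/-- The two gates that turn the oracle into a block-encoding of the shifted operator. The sign of
`lam` is absorbed into one of them. -/
lemma exists_shift_gates {α lam : ℝ} (hα : 0 < α) :
    ∃ L R : Matrix.unitaryGroup (Fin 2) ℂ,
      (L : Matrix (Fin 2) (Fin 2) ℂ) 0 1 * (R : Matrix (Fin 2) (Fin 2) ℂ) 1 0 =
        ((α / (α + |lam|) : ℝ) : ℂ) ∧
      (L : Matrix (Fin 2) (Fin 2) ℂ) 0 0 * (R : Matrix (Fin 2) (Fin 2) ℂ) 0 0 =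
        ((-lam / (α + |lam|) : ℝ) : ℂ) := by
  have hpos : 0 < α + |lam| := by positivity
  obtain ⟨σ, hσ, hσl⟩ : ∃ σ : ℝ, σ ^ 2 = 1 ∧ σ * |lam| = -lam := by
    rcases le_total 0 lam with h | h
    · exact ⟨-1, by norm_num, by rw [abs_of_nonneg h]; ring⟩
    · exact ⟨1, by norm_num, by rw [abs_of_nonpos h]; ring⟩
  have hc2 : √(|lam| / (α + |lam|)) ^ 2 = |lam| / (α + |lam|) := Real.sq_sqrt (by positivity)
  have hs2 : √(α / (α + |lam|)) ^ 2 = α / (α + |lam|) := Real.sq_sqrt (by positivity)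
  set c := √(|lam| / (α + |lam|))
  set s := √(α / (α + |lam|))
  have hcs : c ^ 2 + s ^ 2 = 1 := by
    rw [hc2, hs2, ← add_div, add_comm, div_self hpos.ne']
  refine ⟨⟨_, exists_unitary_of_sq_add_sq hσ hcs⟩,
    star ⟨_, exists_unitary_of_sq_add_sq (one_pow 2) hcs⟩, ?_, ?_⟩
  · rw [← hs2]
    simp [Matrix.star_apply]
    ring
  · have e : -lam / (α + |lam|) = σ * c ^ 2 := by rw [hc2, ← hσl, mul_div_assoc]
    rw [e]
    simp [Matrix.star_apply]
    ring

section

variable {n : ℕ}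

open scoped Matrix.Norms.L2Operator in
lemma isBlockEncoding_one {a : ℕ} {ε : ℝ} {V : Op (Reg a n)} {A B : Op (Fin n)}
    (hV : V ∈ Matrix.unitaryGroup (Basis (Reg a n)) ℂ) (hB : zeroBlock V = B)
    (h : ‖A - B‖ ≤ ε) : IsBlockEncoding 1 a ε V A := by
  refine ⟨hV, ?_⟩
  rw [hB, Complex.ofReal_one, one_smul]
  exact h

open scoped Matrix.Norms.L2Operator in
lemma isBlockEncoding_one_self {a : ℕ} {V : Op (Reg a n)} {A : Op (Fin n)}
    (hV : V ∈ Matrix.unitaryGroup (Basis (Reg a n)) ℂ) (hA : zeroBlock V = A) :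
    IsBlockEncoding 1 a 0 V A :=
  isBlockEncoding_one hV hA ((congrArg norm (sub_self A)).trans norm_zero).le

lemma shifted_isHermitian {H : Op (Fin n)} (hH : H.IsHermitian) (α lam : ℝ) :
    (shifted H α lam).IsHermitian := by
  have h : H.conjTranspose = H := hH
  change (shifted H α lam).conjTranspose = _
  simp [shifted, Matrix.conjTranspose_smul, h]

lemma shifted_eq {m : ℕ} {α lam : ℝ} {H : Op (Fin n)} {U : Op (Reg m n)}
    (hU : IsBlockEncoding α m 0 U H) :
    ((α / (α + |lam|) : ℝ) : ℂ) • zeroBlock U + ((-lam / (α + |lam|) : ℝ) : ℂ) • (1 : Op (Fin n)) =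
      shifted H α lam := by
  rw [shifted, eq_smul_zeroBlock hU, smul_sub, smul_smul, smul_smul, sub_eq_add_neg, ← neg_smul]
  congr 2
  · push_cast; ring
  · push_cast; ring

end

lemma scaledGap_pos {α Δ : ℝ} (hα : 0 < α) (hΔ : 0 < Δ) : 0 < scaledGap α Δ :=
  lt_min (by positivity) (by positivity)

lemma two_sevenths_le : (2 / 7 : ℝ) ≤ 1 / √12 := by
  rw [le_div_iff₀ (by positivity)]
  have : √12 ≤ 7 / 2 := Real.sqrt_le_iff.2 ⟨by norm_num, by norm_num⟩
  linarith

lemma scaledGap_lt_one (α Δ : ℝ) : scaledGap α Δ < 1 := by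
  refine (min_le_right _ _).trans_lt ?_
  rw [div_lt_one (by positivity)]
  exact Real.lt_sqrt_of_sq_lt (by norm_num)

lemma le_scaledGap {α Δ : ℝ} (hα : 0 < α) (hΔ : 0 < Δ) (h : Δ ≤ 2 * α) :
    Δ / (7 * α) ≤ scaledGap α Δ := by
  refine le_min ?_ (le_trans ?_ two_sevenths_le)
  · gcongr
    norm_num
  · rw [div_le_div_iff₀ (by positivity) (by norm_num)]
    linarith

/-- A degree that achieves accuracy `ε` and is of order `(α / Δ) log (2 / ε)`. If the gap is at most
`2 α`, the last quantity is bounded below, so that additive constants can be absorbed. -/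
lemma exists_degree {α Δ ε : ℝ} (hα : 0 < α) (hΔ : 0 < Δ) (h : Δ ≤ 2 * α) (hε : 0 < ε)
    (hε1 : ε ≤ 1) :
    ∃ ℓ : ℕ, 4 * filterBound ℓ (scaledGap α Δ) ≤ ε ∧
      (ℓ : ℝ) ≤ 24 * (α / Δ * Real.log (2 / ε)) ∧ 1 ≤ 3 * (α / Δ * Real.log (2 / ε)) := by
  have hδ := scaledGap_pos hα hΔ
  have hδ1 := scaledGap_lt_one α Δ
  have hδ7 := le_scaledGap hα hΔ h
  set δ := scaledGap α Δ
  have hlog2 : (2 / 3 : ℝ) ≤ Real.log 2 := by linarith [Real.log_two_gt_d9]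
  have hlog : Real.log 2 ≤ Real.log (2 / ε) := by
    apply Real.log_le_log two_pos
    rw [le_div_iff₀ hε]
    linarith
  set T := α / Δ * Real.log (2 / ε) with hT
  have hαΔ : 1 / 2 ≤ α / Δ := by
    rw [div_le_div_iff₀ two_pos hΔ]
    linarith
  have hT1 : 1 ≤ 3 * T := by
    have : 1 / 2 * (2 / 3) ≤ T := mul_le_mul hαΔ (hlog2.trans hlog) (by norm_num) (by positivity)
    linarith
  have hlog8 : Real.log (8 / ε) = Real.log (2 / ε) + 2 * Real.log 2 := by
    rw [show (8 / ε : ℝ) = 2 / ε * 2 ^ 2 by ring, Real.log_mul (by positivity) (by norm_num),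
      Real.log_pow]
    norm_num
  have hx : Real.log (8 / ε) / δ ≤ 21 * T := by
    rw [div_le_iff₀ hδ]
    have h1 : Real.log (8 / ε) ≤ 3 * Real.log (2 / ε) := by linarith
    have h2 : 21 * T * (Δ / (7 * α)) = 3 * Real.log (2 / ε) := by
      rw [hT]
      field_simp
      ring
    have h3 : 21 * T * (Δ / (7 * α)) ≤ 21 * T * δ := mul_le_mul_of_nonneg_left hδ7 (by linarith)
    linarith
  refine ⟨⌈Real.log (8 / ε) / δ⌉₊, ?_, ?_, hT1⟩
  · have h1 : Real.log (8 / ε) ≤ ⌈Real.log (8 / ε) / δ⌉₊ * δ := by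
      rw [← div_le_iff₀ hδ]
      exact Nat.le_ceil _
    have h2 : Real.exp (-(⌈Real.log (8 / ε) / δ⌉₊ * δ)) ≤ ε / 8 := by
      rw [← Real.exp_log (show 0 < ε / 8 by positivity), Real.exp_le_exp]
      have : Real.log (ε / 8) = -Real.log (8 / ε) := by rw [← Real.log_inv, inv_div]
      linarith
    have h3 := filterBound_le_exp (ℓ := ⌈Real.log (8 / ε) / δ⌉₊) hδ hδ1
    linarith
  · have h0 : 0 ≤ Real.log (8 / ε) / δ := by
      refine div_nonneg ?_ hδ.le
      linarith
    have := Nat.ceil_lt_add_one h0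
    linarith

open scoped Matrix.Norms.L2Operator in
/-- The reflection polynomial of the shifted operator approximates the reflection. -/
lemma norm_reflection_sub_reflectionPoly_le {m n ℓ : ℕ} {α lam Δ ε : ℝ} {H : Op (Fin n)}
    {U : Op (Reg m n)} (hα : 0 < α) (hΔ : 0 < Δ) (hε : 0 ≤ ε)
    (hℓ : 4 * filterBound ℓ (scaledGap α Δ) ≤ ε) (hH : H.IsHermitian)
    (hU : IsBlockEncoding α m 0 U H) (hlam : IsGappedEigenvalue H lam Δ) :
    ‖reflection H lam - Polynomial.aeval (shifted H α lam) (reflectionPoly ℓ (scaledGap α Δ))‖ ≤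
      ε := by
  have hδ := scaledGap_pos hα hΔ
  have hδ1 := scaledGap_lt_one α Δ
  refine norm_reflection_sub_aeval_shifted_le hH hε fun μ hμ => le_trans ?_ hℓ
  have hl := abs_le_of_isEigenvalue hα hU hlam.1
  have hm := abs_le_of_isEigenvalue hα hU hμ
  have hpos : 0 < α + |lam| := by positivity
  split_ifs with h
  · rw [h, sub_self, mul_zero]
    exact abs_reflectionPoly_eval_zero_sub_one_le hδ hδ1
  · have hgap := hlam.2 μ hμ h
    have habs : |(α + |lam|)⁻¹ * (μ - lam)| = |μ - lam| / (α + |lam|) := by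
      rw [abs_mul, abs_of_pos (inv_pos.2 hpos), div_eq_inv_mul]
    rw [sub_neg_eq_add]
    refine abs_reflectionPoly_eval_add_one_le hδ hδ1 ?_ ?_
    · rw [habs]
      refine (min_le_left _ _).trans ?_
      have h2 : α + |lam| ≤ 2 * α := by linarith
      gcongr
    · rw [habs, div_le_one hpos]
      exact (abs_sub _ _).trans (by linarith)

end EigFilter

theorem mainTheorem5 :
    ∃ C : ℝ, 0 < C ∧
      ∀ (n m : ℕ) (α lam Δ ε : ℝ), 0 < α → 0 < Δ → 0 < ε → ε ≤ 1 →
        ∃ (ℓ : ℕ) (c : EigFilter.Circuit (EigFilter.Reg m n) (EigFilter.Reg (m + 2) n)),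
          EigFilter.Circuit.queries c = 2 * ℓ ∧
          (EigFilter.Circuit.queries c : ℝ) ≤ C * (α / Δ) * Real.log (2 / ε) ∧
          (EigFilter.Circuit.gates c : ℝ) ≤ C * (((m : ℝ) + 1) * α / Δ) * Real.log (2 / ε) ∧
          ∀ (H : EigFilter.Op (Fin n)) (U : EigFilter.Op (EigFilter.Reg m n)),
            H.IsHermitian →
            EigFilter.IsBlockEncoding α m 0 U H →
            EigFilter.IsGappedEigenvalue H lam Δ →
              EigFilter.IsBlockEncoding 1 (m + 2) 0 (EigFilter.Circuit.eval U c)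
                (Polynomial.aeval (EigFilter.shifted H α lam)
                  (EigFilter.reflectionPoly ℓ (EigFilter.scaledGap α Δ))) ∧
              EigFilter.IsBlockEncoding 1 (m + 2) ε (EigFilter.Circuit.eval U c)
                (EigFilter.reflection H lam) := by
  open EigFilter in
  refine ⟨3400, by norm_num, fun n m α lam Δ ε hα hΔ hε hε1 => ?_⟩
  have hlog : 0 ≤ Real.log (2 / ε) := by
    apply Real.log_nonneg
    rw [le_div_iff₀ hε]
    linarith
  rcases lt_or_ge (2 * α) Δ with hgap | hgap
  · -- The spectrum lies in `[-α, α]`, so `H = lam I` and the empty circuit is a valid choice.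
    refine ⟨0, [], rfl, ?_, ?_, fun H U hH hU hlam => ?_⟩
    · simp only [Circuit.queries, List.map_nil, List.sum_nil, Nat.cast_zero]
      positivity
    · simp only [Circuit.gates, List.map_nil, List.sum_nil, Nat.cast_zero]
      positivity
    · have hun := Circuit.eval_mem_unitaryGroup hU.1 (Q := Reg (m + 2) n) []
      have hz : zeroBlock (Circuit.eval U ([] : Circuit (Reg m n) (Reg (m + 2) n))) =
          Polynomial.aeval (shifted H α lam) (reflectionPoly 0 (scaledGap α Δ)) := by
        rw [reflectionPoly_zero, map_one]
        ext i j
        have hinj : (Sum.elim 0 i : Basis (Reg (m + 2) n)) =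
            (Sum.elim 0 j : Basis (Reg (m + 2) n)) ↔ i = j :=
          ⟨fun h => funext fun k => congrFun h (Sum.inr k), fun h => by rw [h]⟩
        simp only [zeroBlock, Circuit.eval, Matrix.of_apply, Matrix.one_apply, hinj]
      refine ⟨isBlockEncoding_one_self hun hz,
        isBlockEncoding_one hun hz ?_⟩
      refine norm_reflection_sub_aeval_shifted_le hH hε.le fun μ hμ => ?_
      have hμl : μ = lam := by
        by_contra h
        have h1 := hlam.2 μ hμ h
        have h2 := abs_le_of_isEigenvalue hα hU hlam.1
        have h3 := abs_le_of_isEigenvalue hα hU hμ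
        have h4 := abs_sub μ lam
        linarith
      rw [if_pos hμl, reflectionPoly_zero, Polynomial.eval_one, sub_self, abs_zero]
      exact hε.le
  · obtain ⟨ℓ, hℓ, hℓT, hT⟩ := exists_degree hα hΔ hgap hε hε1
    have hδ := scaledGap_pos hα hΔ
    have hδ1 := scaledGap_lt_one α Δ
    obtain ⟨s, hs, hsS⟩ := exists_reflectionPoly_eq_comp ℓ (scaledGap α Δ)
    obtain ⟨φ, hφ⟩ := exists_phases_of_abs_le_one hs fun y hy0 hy1 => by
      have h := abs_reflectionPoly_eval_le_one (ℓ := ℓ) hδ hδ1 (x := √y)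
        (by rw [abs_of_nonneg (Real.sqrt_nonneg y)]; exact Real.sqrt_le_one.2 hy1)
      rw [hsS] at h
      simpa [Real.sq_sqrt hy0] using h
    rw [← hsS] at hφ
    obtain ⟨L, R, hL, hR⟩ := exists_shift_gates (lam := lam) hα
    set T := α / Δ * Real.log (2 / ε) with hTdef
    refine ⟨ℓ, filterCircuit m n L R φ (2 * ℓ), filterCircuit_queries _ _ _ _, ?_, ?_,
      fun H U hH hU hlam => ?_⟩
    · rw [filterCircuit_queries, mul_assoc]
      push_cast
      linarith
    · have h1 : ((filterCircuit m n L R φ (2 * ℓ)).gates : ℝ) ≤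
          65 * ((m : ℝ) + 1) * (2 * ℓ + 1) := by
        exact_mod_cast filterCircuit_gates_le L R φ (2 * ℓ)
      have h2 : 3400 * (((m : ℝ) + 1) * α / Δ) * Real.log (2 / ε) = ((m : ℝ) + 1) * (3400 * T) := by
        rw [hTdef]
        ring
      rw [h2]
      have h3 : ((m : ℝ) + 1) * (65 * (2 * ℓ + 1)) ≤ ((m : ℝ) + 1) * (3400 * T) :=
        mul_le_mul_of_nonneg_left (by linarith) (by positivity)
      linarith
    · have hun := Circuit.eval_mem_unitaryGroup hU.1 (filterCircuit m n L R φ (2 * ℓ))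
      have hz := zeroBlock_filterCircuit_eval hU.1 (L := L) (R := R)
        (shifted_isHermitian hH α lam) (by rw [hL, hR]; exact shifted_eq hU) hφ
      exact ⟨isBlockEncoding_one_self hun hz,
        isBlockEncoding_one hun hz
          (norm_reflection_sub_reflectionPoly_le hα hΔ hε.le hℓ hH hU hlam)⟩
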